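/- All graphs are finite, simple and undirected. For a graph $G$ on $n$ vertices let $m(G,k)$ be the number of sets of $k$ pairwise nonincident edges of $G$ (with $m(G,0)=1$), and let $\mu(G,x)=\sum_{k\ge 0}(-1)^k m(G,k)x^{n-2k}$ be its matching polynomial; its roots are the matching roots of $G$. Let $z(G)$ be the number of distinct matching roots of $G$. A star is a complete bipartite graph $K_{1,s}$ with $s\ge 1$. Define the following graphs. - $K(k,t;\ell)$, for integers $t\ge 0$ and $1\le \ell\le k$: to the disjoint union $K_{1,k}\cup tK_1$ add one vertex $u$, joined to exactly $\ell$ leaves of the star $K_{1,k}$ and to all $t$ isolated vertices, and not joined to the centre of the star. - $K'(k,t;\ell)$, for integers $k\ge 1$, $t\ge 0$ and $0\le \ell\le k$: to $K_{1,k}\cup tK_1$ add one vertex $u$, joined to the centre of the star, to exactly $\ell$ of its leaves, and to all $t$ isolated vertices. - $L(t,\ell)$, for integers $t\ge 0$ and $1\le\ell\le 3$: to $K_3\cup tK_1$ add one vertex, joined to exactly $\ell$ vertices of the triangle and to all $t$ isolated vertices. - $T(r,k)$, for integers $r,k\ge 1$: to the disjoint union of $r$ copies of $K_{1,k}$ add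 one vertex, joined exactly to the $r$ centres of the stars. - $S(r,s)$, for integers $r\ge 1$ and $r\le s\le 2r$: to the disjoint union of $r$ copies of $K_2$ add one vertex, joined to both ends of $s-r$ of the copies and to exactly one end of each of the other $2r-s$ copies. (For $K_{1,1}$ one of the two vertices is chosen as the centre and the other is the leaf.) Theorem. Let $G$ be a connected graph. (i) If $z(G)=2$, then $G\cong K_2$. (ii) If $z(G)=3$, then $G$ is a star or $G\cong K_3$. (iii) If $z(G)=4$, then $G$ is a non-star graph with exactly $4$ vertices. (iv) If $z(G)=5$, then $G$ is isomorphic to one of the graphs $K(k,t;\ell)$, $K'(k,t;\ell)$, $L(t,\ell)$, $T(r,k)$, $S(r,s)$ for some integers $k,r,s,t,\ell$ in the ranges given above, or $G$ is a non-star graph with exactly $5$ vertices. -/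

import Mathlib

open scoped Polynomial

namespace MatchingRoots

/-- `M` is a matching of `G`: a set of pairwise nonincident edges. -/
def IsEdgeMatching {V : Type*} (G : SimpleGraph V) (M : Finset (Sym2 V)) : Prop :=
  (∀ e ∈ M, e ∈ G.edgeSet) ∧ ∀ e ∈ M, ∀ f ∈ M, e ≠ f → ∀ v, v ∈ e → v ∉ f

/-- `m(G, k)`, the number of `k`-matchings of `G`. -/
noncomputable def numMatchings {V : Type*} (G : SimpleGraph V) (k : ℕ) : ℕ :=
  {M : Finset (Sym2 V) | IsEdgeMatching G M ∧ M.card = k}.ncard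

/-- The matching polynomial `μ(G, x) = ∑ₖ (-1)ᵏ m(G, k) xⁿ⁻²ᵏ`, `n` the number of vertices.
The sum runs over the `k` with `2 k ≤ n`; no larger matching exists. -/
noncomputable def matchingPoly {V : Type*} [Fintype V] (G : SimpleGraph V) : ℤ[X] :=
  ∑ k ∈ Finset.range (Fintype.card V / 2 + 1),
    Polynomial.C ((-1) ^ k * (numMatchings G k : ℤ)) * Polynomial.X ^ (Fintype.card V - 2 * k)

/-- `z(G)`, the number of distinct (complex) roots of the matching polynomial of `G`. -/
noncomputable def numMatchingRoots {V : Type*} [Fintype V] (G : SimpleGraph V) : ℕ :=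
  ((matchingPoly G).rootSet ℂ).ncard

/-- The star `K_{1,k}`; its centre is `Sum.inl 0`, its leaves are the `Sum.inr i`. -/
def star (k : ℕ) : SimpleGraph (Fin 1 ⊕ Fin k) :=
  completeBipartiteGraph (Fin 1) (Fin k)

/-- `G` is (isomorphic to) a star `K_{1,s}`, `s ≥ 1`. -/
def IsStar {V : Type*} (G : SimpleGraph V) : Prop :=
  ∃ s : ℕ, 1 ≤ s ∧ Nonempty (G ≃g star s)

/-- The graph obtained from `H` by adding one new vertex `none`, joined exactly to the vertices
in `A`. -/
def addVertex {W : Type*} (H : SimpleGraph W) (A : Set W) : SimpleGraph (Option W) where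
  Adj
    | some v, some w => H.Adj v w
    | none, some w => w ∈ A
    | some v, none => v ∈ A
    | none, none => False
  symm := ⟨by
    rintro (_ | v) (_ | w) h
    · exact h
    · exact h
    · exact h
    · exact H.adj_symm h⟩
  loopless := ⟨by
    rintro (_ | v) h
    · exact h
    · exact H.loopless.irrefl v h⟩

/-- The disjoint union of `r` copies of `H`. -/
def copies {W : Type*} (r : ℕ) (H : SimpleGraph W) : SimpleGraph (Fin r × W) where
  Adj x y := x.1 = y.1 ∧ H.Adj x.2 y.2
  symm := ⟨fun _ _ h => ⟨h.1.symm, H.adj_symm h.2⟩⟩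
  loopless := ⟨fun x h => H.loopless.irrefl x.2 h.2⟩

/-- `K(k, t; ℓ)`: to `K_{1,k} ∪ t K₁` add a vertex `u` joined to `ℓ` leaves of the star and to the
`t` isolated vertices, but not to the centre of the star. -/
def graphK (k t l : ℕ) : SimpleGraph (Option ((Fin 1 ⊕ Fin k) ⊕ Fin t)) :=
  addVertex (star k ⊕g (⊥ : SimpleGraph (Fin t)))
    {w | (∃ i : Fin k, (i : ℕ) < l ∧ w = Sum.inl (Sum.inr i)) ∨ ∃ j : Fin t, w = Sum.inr j}

/-- `K'(k, t; ℓ)`: the same as `K(k, t; ℓ)`, but `u` is also joined to the centre of the star. -/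
def graphK' (k t l : ℕ) : SimpleGraph (Option ((Fin 1 ⊕ Fin k) ⊕ Fin t)) :=
  addVertex (star k ⊕g (⊥ : SimpleGraph (Fin t)))
    {w | w = Sum.inl (Sum.inl 0) ∨ (∃ i : Fin k, (i : ℕ) < l ∧ w = Sum.inl (Sum.inr i)) ∨
      ∃ j : Fin t, w = Sum.inr j}

/-- `L(t, ℓ)`: to `K₃ ∪ t K₁` add a vertex joined to `ℓ` vertices of the triangle and to the `t`
isolated vertices. -/
def graphL (t l : ℕ) : SimpleGraph (Option (Fin 3 ⊕ Fin t)) :=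
  addVertex ((⊤ : SimpleGraph (Fin 3)) ⊕g (⊥ : SimpleGraph (Fin t)))
    {w | (∃ i : Fin 3, (i : ℕ) < l ∧ w = Sum.inl i) ∨ ∃ j : Fin t, w = Sum.inr j}

/-- `T(r, k)`: to `r K_{1,k}` add a vertex joined exactly to the `r` centres of the stars. -/
def graphT (r k : ℕ) : SimpleGraph (Option (Fin r × (Fin 1 ⊕ Fin k))) :=
  addVertex (copies r (star k)) {w | w.2 = Sum.inl 0}

/-- `S(r, s)`: to `r K₂` add a vertex joined by `s` edges, namely to both ends of the first
`s - r` copies of `K₂` and to one end of each other copy. -/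
def graphS (r s : ℕ) : SimpleGraph (Option (Fin r × Fin 2)) :=
  addVertex (copies r (⊤ : SimpleGraph (Fin 2)))
    {w | w.2 = 0 ∨ (w.2 = 1 ∧ (w.1 : ℕ) + r < s)}

end MatchingRoots

/-!
Write `F(S)` for the matching polynomial of the induced subgraph `G[S]`, with a weight for every
vertex, and `m(S)` for the multiplicity of a fixed real number `θ` as a root of `F(S)` when all
weights equal the variable `x`. All roots are real (`mp_splits`) and they are symmetric about `0`.

The Rayleigh difference `F(S - u) F(S - v) - F(S) F(S - u - v)` is a sum of squares `F(S - P)²`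
over the paths `P` from `u` to `v` (`rayleigh_recurrence`, `rayleigh_path`). Comparing orders of
vanishing at `θ` shows that deleting a vertex changes `m` by at most one and that deleting a path
lowers `m` by at most one. Summed over all roots, the latter says that a path has at most as many
vertices as there are distinct roots (`length_le_card_mroots`).

The other tool is Gallai's lemma for matching roots (`exists_mmult_erase_eq_add_one`): a root of
multiplicity `m ≥ 2` of a connected graph has multiplicity `m + 1` after the deletion of some
vertex `u`. Call a vertex essential if its deletion lowers `m`. A neighbour of an essential vertex
is essential or raises `m`. The relation "deleting both lowers `m` only once" contains the edges
between essential vertices, and it is transitive (`essential_trans`), because the Rayleigh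
difference stays nonnegative when the weight of a third vertex is perturbed. So if no vertex
raised `m`, all pairs would be related, no vertex would be essential in `G - u`, and `m` would be
`1`. Since a vertex can raise `m` only if `θ` is not the largest root, the largest root is simple.

With two or three distinct roots there is no path on three, respectively four vertices, which
leaves `K₂`, respectively stars and `K₃`. With four or five distinct roots the positive roots are
a simple root and some `β`, and the order of `G` is `2 + 2 m_β + m_0`. If `m_β ≥ 2` or `m_0 ≥ 2`,
Gallai's lemma yields `u` such that `G - u` has at most three distinct roots, hence only stars,
triangles and isolated vertices as components; with four roots a degree count already excludes
this. Otherwise `G` has four, respectively five vertices.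

* If `m_β = 1` and `m_0 ≥ 2`, the multiplicity of `0` in `G - u` leaves room for one nontrivial
  component only, and `G` is a `K(k, t; ℓ)`, `K'(k, t; ℓ)` or `L(t, ℓ)`.
* If `m_β ≥ 2`, then `±β` are the only nonzero roots of `G - u`, so all stars have `β²` leaves.
  The multiplicity of `0` rules out isolated vertices. A path on six vertices would arise from a
  triangle, or from a leaf adjacent to `u` unless the stars are single edges. So `G` is a `T(r,
  k)` or an `S(r, s)`.
-/

namespace MatchingRoots

/-! ### The weighted matching polynomial -/

section Weighted

open scoped Classical

variable {V R : Type*} [CommRing R] (G : SimpleGraph V)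

/-- The matchings of the induced subgraph `G[S]`. -/
noncomputable def matchingsIn (S : Finset V) : Finset (Finset (Sym2 V)) :=
  S.sym2.powerset.filter (IsEdgeMatching G)

/-- The matching polynomial of `G[S]` with a weight `x v` for every vertex `v`:
the sum over the matchings `M` of `(-1)^|M|` times the weights of the vertices that `M` misses. -/
noncomputable def weightedMP (x : V → R) (S : Finset V) : R :=
  ∑ M ∈ matchingsIn G S, (-1) ^ M.card * ∏ v ∈ S with ∀ e ∈ M, v ∉ e, x v

variable {G}

lemma mem_matchingsIn {S : Finset V} {M : Finset (Sym2 V)} :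
    M ∈ matchingsIn G S ↔ (∀ e ∈ M, ∀ v ∈ e, v ∈ S) ∧ IsEdgeMatching G M := by
  simp only [matchingsIn, Finset.mem_filter, Finset.mem_powerset, Finset.subset_iff,
    Finset.mem_sym2_iff]

lemma weightedMP_congr {x y : V → R} {S : Finset V} (h : ∀ v ∈ S, x v = y v) :
    weightedMP G x S = weightedMP G y S := by
  refine Finset.sum_congr rfl fun M _ => ?_
  congr 1
  exact Finset.prod_congr rfl fun v hv => h v (Finset.mem_filter.1 hv).1

lemma map_weightedMP {R' : Type*} [CommRing R'] (φ : R →+* R') (x : V → R) (S : Finset V) :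
    φ (weightedMP G x S) = weightedMP G (fun v => φ (x v)) S := by
  simp [weightedMP, map_sum, map_prod]

lemma weightedMP_empty (x : V → R) : weightedMP G x ∅ = 1 := by
  have : matchingsIn G ∅ = {∅} := by
    ext M
    rw [mem_matchingsIn, Finset.mem_singleton]
    constructor
    · rintro ⟨h, -⟩
      refine Finset.eq_empty_of_forall_notMem fun e he => ?_
      induction e with
      | h a b => simpa using h _ he a (Sym2.mem_mk_left a b)
    · rintro rfl
      simp [IsEdgeMatching]
  simp [weightedMP, this]

lemma matchingsIn_filter_uncovered {S : Finset V} {u : V} :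
    (matchingsIn G S).filter (fun M => ∀ e ∈ M, u ∉ e) = matchingsIn G (S.erase u) := by
  ext M
  simp only [Finset.mem_filter, mem_matchingsIn, Finset.mem_erase]
  constructor
  · rintro ⟨⟨h1, h2⟩, h3⟩
    exact ⟨fun e he v hv => ⟨fun hvu => h3 e he (hvu ▸ hv), h1 e he v hv⟩, h2⟩
  · rintro ⟨h1, h2⟩
    exact ⟨⟨fun e he v hv => (h1 e he v hv).2, h2⟩, fun e he hu => (h1 e he u hu).1 rfl⟩

lemma insert_mem_matchingsIn {S : Finset V} {u w : V} (hu : u ∈ S) (hw : w ∈ S)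
    (ha : G.Adj u w) {M : Finset (Sym2 V)} (hM : M ∈ matchingsIn G ((S.erase u).erase w)) :
    insert s(u, w) M ∈ matchingsIn G S := by
  rw [mem_matchingsIn] at hM ⊢
  obtain ⟨h1, h2, h3⟩ := hM
  simp only [Finset.mem_erase] at h1
  refine ⟨?_, ?_, ?_⟩
  · intro e he v hv
    rcases Finset.mem_insert.1 he with rfl | he
    · rcases Sym2.mem_iff.1 hv with rfl | rfl <;> assumption
    · exact (h1 e he v hv).2.2
  · intro e he
    rcases Finset.mem_insert.1 he with rfl | he
    · exact ha
    · exact h2 e he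
  · intro e he f hf hne v hve hvf
    rcases Finset.mem_insert.1 he with rfl | he' <;> rcases Finset.mem_insert.1 hf with rfl | hf'
    · exact hne rfl
    · rcases Sym2.mem_iff.1 hve with rfl | rfl
      · exact (h1 f hf' _ hvf).2.1 rfl
      · exact (h1 f hf' _ hvf).1 rfl
    · rcases Sym2.mem_iff.1 hvf with rfl | rfl
      · exact (h1 e he' _ hve).2.1 rfl
      · exact (h1 e he' _ hve).1 rfl
    · exact h3 e he' f hf' hne v hve hvf

lemma erase_mem_matchingsIn {S : Finset V} {u w : V} {M : Finset (Sym2 V)}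
    (hM : M ∈ matchingsIn G S) (he : s(u, w) ∈ M) :
    M.erase s(u, w) ∈ matchingsIn G ((S.erase u).erase w) := by
  rw [mem_matchingsIn] at hM ⊢
  obtain ⟨h1, h2, h3⟩ := hM
  refine ⟨fun f hf v hv => ?_, fun f hf => h2 f (Finset.mem_of_mem_erase hf),
    fun f hf g hg => h3 f (Finset.mem_of_mem_erase hf) g (Finset.mem_of_mem_erase hg)⟩
  obtain ⟨hne, hf'⟩ := Finset.mem_erase.1 hf
  simp only [Finset.mem_erase]
  refine ⟨?_, ?_, h1 f hf' v hv⟩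
  · rintro rfl
    exact h3 f hf' _ he hne v hv (Sym2.mem_mk_right u v)
  · rintro rfl
    exact h3 f hf' _ he hne v hv (Sym2.mem_mk_left v w)

/-- Expansion of the matching polynomial at a vertex: a matching misses `u` or contains exactly one
edge at `u`. -/
theorem weightedMP_recurrence (x : V → R) {S : Finset V} {u : V} (hu : u ∈ S) :
    weightedMP G x S = x u * weightedMP G x (S.erase u) -
      ∑ w ∈ S.erase u with G.Adj u w, weightedMP G x ((S.erase u).erase w) := by
  have h1 : ∑ M ∈ matchingsIn G S with ∀ e ∈ M, u ∉ e,
      (-1 : R) ^ M.card * ∏ v ∈ S with ∀ e ∈ M, v ∉ e, x v =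
      x u * weightedMP G x (S.erase u) := by
    rw [matchingsIn_filter_uncovered, weightedMP, Finset.mul_sum]
    refine Finset.sum_congr rfl fun M hM => ?_
    have : S.filter (fun v => ∀ e ∈ M, v ∉ e) =
        insert u ((S.erase u).filter (fun v => ∀ e ∈ M, v ∉ e)) := by
      ext v
      simp only [Finset.mem_filter, Finset.mem_insert, Finset.mem_erase]
      constructor
      · rintro ⟨hv, h⟩
        by_cases hvu : v = u
        · exact Or.inl hvu
        · exact Or.inr ⟨⟨hvu, hv⟩, h⟩
      · rintro (rfl | ⟨⟨-, hv⟩, h⟩)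
        · refine ⟨hu, fun e he hue => ?_⟩
          exact Finset.notMem_erase _ _ ((mem_matchingsIn.1 hM).1 e he _ hue)
        · exact ⟨hv, h⟩
    rw [this, Finset.prod_insert (by simp)]
    ring
  have h2 : ∑ M ∈ matchingsIn G S with ¬ ∀ e ∈ M, u ∉ e,
      (-1 : R) ^ M.card * ∏ v ∈ S with ∀ e ∈ M, v ∉ e, x v =
      - ∑ w ∈ S.erase u with G.Adj u w, weightedMP G x ((S.erase u).erase w) := by
    simp only [weightedMP]
    rw [← Finset.sum_neg_distrib]
    simp only [← Finset.sum_neg_distrib]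
    rw [Finset.sum_sigma']
    symm
    refine Finset.sum_bij (fun p _ => insert s(u, p.1) p.2) ?_ ?_ ?_ ?_
    · rintro ⟨w, M⟩ hp
      simp only [Finset.mem_sigma, Finset.mem_filter, Finset.mem_erase] at hp
      simp only [Finset.mem_filter]
      refine ⟨insert_mem_matchingsIn hu hp.1.1.2 hp.1.2 hp.2, fun h => ?_⟩
      exact h _ (Finset.mem_insert_self _ _) (Sym2.mem_mk_left u w)
    · rintro ⟨w, M⟩ hp ⟨w', M'⟩ hp' heq
      simp only [Finset.mem_sigma, Finset.mem_filter, Finset.mem_erase] at hp hp'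
      have hM := (mem_matchingsIn.1 hp.2).1
      have hM' := (mem_matchingsIn.1 hp'.2).1
      have key : ∀ {w : V} {M : Finset (Sym2 V)},
          (∀ e ∈ M, ∀ v ∈ e, v ∈ (S.erase u).erase w) → ∀ y, s(u, y) ∉ M := by
        intro w M h y hy
        have := h _ hy u (Sym2.mem_mk_left u y)
        simp at this
      have hw : w = w' := by
        have : s(u, w) ∈ insert s(u, w') M' := heq ▸ Finset.mem_insert_self _ _
        rcases Finset.mem_insert.1 this with h | h
        · exact Sym2.congr_right.1 h
        · exact absurd h (key hM' w)
      subst hw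
      have : M = M' := by
        have h' := congrArg (fun N => Finset.erase N s(u, w)) heq
        simpa [Finset.erase_insert (key hM w), Finset.erase_insert (key hM' w)] using h'
      rw [this]
    · intro M hM
      simp only [Finset.mem_filter, not_forall, not_not] at hM
      obtain ⟨hM, e, he, hue⟩ := hM
      obtain ⟨w, rfl⟩ := hue
      have hMS := mem_matchingsIn.1 hM
      have hadj : G.Adj u w := hMS.2.1 _ he
      refine ⟨⟨w, M.erase s(u, w)⟩, ?_, Finset.insert_erase he⟩
      simp only [Finset.mem_sigma, Finset.mem_filter, Finset.mem_erase]
      exact ⟨⟨⟨hadj.ne', hMS.1 _ he w (Sym2.mem_mk_right u w)⟩, hadj⟩,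
        erase_mem_matchingsIn hM he⟩
    · rintro ⟨w, M⟩ hp
      simp only [Finset.mem_sigma, Finset.mem_filter, Finset.mem_erase] at hp
      have hM := (mem_matchingsIn.1 hp.2).1
      have hnot : s(u, w) ∉ M := fun h => by
        have := hM _ h u (Sym2.mem_mk_left u w)
        simp at this
      have hset : S.filter (fun v => ∀ e ∈ insert s(u, w) M, v ∉ e) =
          ((S.erase u).erase w).filter (fun v => ∀ e ∈ M, v ∉ e) := by
        ext v
        simp only [Finset.mem_filter, Finset.mem_insert, forall_eq_or_imp, Sym2.mem_iff, not_or,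
          Finset.mem_erase]
        tauto
      simp only [hset, Finset.card_insert_of_notMem hnot, pow_succ]
      ring
  rw [weightedMP, ← Finset.sum_filter_add_sum_filter_not _ (fun M => ∀ e ∈ M, u ∉ e), h1, h2,
    sub_eq_add_neg]

/-- The weighted matching polynomial is affine in every single weight. -/
lemma weightedMP_update (x : V → R) {S : Finset V} {w : V} (hw : w ∈ S) (s : R) :
    weightedMP G (Function.update x w (x w + s)) S =
      weightedMP G x S + s * weightedMP G x (S.erase w) := by
  have hc : ∀ T : Finset V, w ∉ T →
      weightedMP G (Function.update x w (x w + s)) T = weightedMP G x T := by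
    intro T hT
    refine weightedMP_congr fun v hv => ?_
    rw [Function.update_of_ne]
    rintro rfl
    exact hT hv
  rw [weightedMP_recurrence _ hw, weightedMP_recurrence x hw, hc _ (by simp),
    Function.update_self, Finset.sum_congr rfl fun v _ => hc _ (by simp)]
  ring

lemma weightedMP_neg (x : V → R) (S : Finset V) :
    weightedMP G (fun v => -x v) S = (-1) ^ S.card * weightedMP G x S := by
  induction S using Finset.strongInduction with
  | H S ih =>
    rcases S.eq_empty_or_nonempty with rfl | ⟨u, hu⟩
    · simp [weightedMP_empty]
    have hcard := Finset.card_erase_add_one hu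
    rw [weightedMP_recurrence _ hu, weightedMP_recurrence x hu, ih _ (Finset.erase_ssubset hu),
      mul_sub, Finset.mul_sum]
    congr 1
    · rw [← hcard]; ring
    · refine Finset.sum_congr rfl fun w hw => ?_
      have hw' := (Finset.mem_filter.1 hw).1
      rw [ih _ ((Finset.erase_ssubset hw').trans (Finset.erase_ssubset hu)), ← hcard,
        ← Finset.card_erase_add_one hw']
      ring

/-- The matching polynomial of a disjoint union is the product of the matching polynomials. -/
lemma weightedMP_union (x : V → R) (S T : Finset V) (hST : Disjoint S T)
    (hE : ∀ a ∈ S, ∀ b ∈ T, ¬ G.Adj a b) :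
    weightedMP G x (S ∪ T) = weightedMP G x S * weightedMP G x T := by
  induction S using Finset.strongInduction with
  | H S ih =>
    rcases S.eq_empty_or_nonempty with rfl | ⟨u, hu⟩
    · simp [weightedMP_empty]
    have huT : u ∉ T := Finset.disjoint_left.1 hST hu
    have her : ∀ A : Finset V, A ⊆ S → ∀ a, a ∉ T → (A ∪ T).erase a = A.erase a ∪ T := by
      intro A _ a ha
      rw [Finset.erase_union_distrib, Finset.erase_eq_of_notMem ha]
    have hih : ∀ A, A ⊂ S → weightedMP G x (A ∪ T) = weightedMP G x A * weightedMP G x T :=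
      fun A hA => ih A hA (Finset.disjoint_of_subset_left hA.1 hST)
        fun a ha => hE a (hA.1 ha)
    rw [weightedMP_recurrence x (Finset.mem_union_left T hu), weightedMP_recurrence x hu,
      her S subset_rfl u huT, hih _ (Finset.erase_ssubset hu)]
    have hfil : (S.erase u ∪ T).filter (G.Adj u) = (S.erase u).filter (G.Adj u) := by
      ext w
      simp only [Finset.mem_filter, Finset.mem_union]
      constructor
      · rintro ⟨h | h, h'⟩
        · exact ⟨h, h'⟩
        · exact absurd h' (hE u hu w h)
      · rintro ⟨h, h'⟩
        exact ⟨Or.inl h, h'⟩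
    rw [hfil, sub_mul, Finset.sum_mul, mul_assoc]
    congr 1
    refine Finset.sum_congr rfl fun w hw => ?_
    have hwS : w ∈ S.erase u := (Finset.mem_filter.1 hw).1
    have hwT : w ∉ T := Finset.disjoint_left.1 hST (Finset.mem_of_mem_erase hwS)
    rw [her _ (Finset.erase_subset _ _) w hwT, hih]
    exact (Finset.erase_ssubset hwS).trans (Finset.erase_ssubset hu)

lemma weightedMP_of_edgeless (x : V → R) {S : Finset V} (h : ∀ a ∈ S, ∀ b ∈ S, ¬ G.Adj a b) :
    weightedMP G x S = ∏ v ∈ S, x v := by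
  induction S using Finset.induction with
  | empty => simp [weightedMP_empty]
  | insert u S hu ih =>
    rw [weightedMP_recurrence x (Finset.mem_insert_self u S), Finset.erase_insert hu,
      Finset.filter_false_of_mem, Finset.sum_empty, Finset.prod_insert hu, sub_zero, ih]
    · exact fun a ha b hb => h a (Finset.mem_insert_of_mem ha) b (Finset.mem_insert_of_mem hb)
    · exact fun w hw => h u (Finset.mem_insert_self _ _) w (Finset.mem_insert_of_mem hw)

end Weighted

/-! ### The Rayleigh difference and the Heilmann–Lieb identity -/

section HeilmannLieb

open scoped Classical

variable {V R : Type*} [CommRing R] (G : SimpleGraph V)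

/-- The Rayleigh difference `F(S - u) F(S - v) - F(S) F(S - u - v)` of the weighted matching
polynomial `F`. -/
noncomputable def rayleigh (x : V → R) (S : Finset V) (u v : V) : R :=
  weightedMP G x (S.erase u) * weightedMP G x (S.erase v) -
    weightedMP G x S * weightedMP G x ((S.erase u).erase v)

variable {G}

/-- Iterating this recursion gives the Heilmann–Lieb identity: the Rayleigh difference is the sum
of `F(S - P)²` over all paths `P` from `u` to `v` in `G[S]`. -/
lemma rayleigh_recurrence (x : V → R) {S : Finset V} {u v : V} (hu : u ∈ S) (hv : v ∈ S)
    (huv : u ≠ v) :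
    rayleigh G x S u v = (if G.Adj u v then weightedMP G x ((S.erase u).erase v) ^ 2 else 0) +
      ∑ w ∈ (S.erase u).erase v with G.Adj u w, rayleigh G x (S.erase u) w v := by
  have hvS : v ∈ S.erase u := Finset.mem_erase.2 ⟨huv.symm, hv⟩
  have huS : u ∈ S.erase v := Finset.mem_erase.2 ⟨huv, hu⟩
  have hsum : ∑ w ∈ S.erase u with G.Adj u w, weightedMP G x ((S.erase u).erase w) =
      (if G.Adj u v then weightedMP G x ((S.erase u).erase v) else 0) +
      ∑ w ∈ (S.erase u).erase v with G.Adj u w, weightedMP G x ((S.erase u).erase w) := by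
    rw [Finset.sum_filter, Finset.sum_filter, ← Finset.add_sum_erase _ _ hvS]
  rw [rayleigh, weightedMP_recurrence x hu, weightedMP_recurrence x huS, hsum,
    Finset.erase_right_comm (s := S) (a := v) (b := u)]
  simp only [rayleigh, Finset.sum_sub_distrib, ← Finset.sum_mul, ← Finset.mul_sum]
  have hcomm : ∑ w ∈ (S.erase u).erase v with G.Adj u w,
      weightedMP G x (((S.erase u).erase v).erase w) =
      ∑ w ∈ (S.erase u).erase v with G.Adj u w,
      weightedMP G x (((S.erase u).erase w).erase v) :=
    Finset.sum_congr rfl fun w _ => by rw [Finset.erase_right_comm]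
  rw [hcomm]
  split_ifs <;> ring

lemma rayleigh_nonneg (x : V → ℝ) {S : Finset V} {u v : V} (hu : u ∈ S) (hv : v ∈ S)
    (huv : u ≠ v) : 0 ≤ rayleigh G x S u v := by
  induction S using Finset.strongInduction generalizing u with
  | H S ih =>
    rw [rayleigh_recurrence x hu hv huv]
    refine add_nonneg (by split_ifs <;> positivity) (Finset.sum_nonneg fun w hw => ?_)
    simp only [Finset.mem_filter, Finset.mem_erase] at hw
    exact ih _ (Finset.erase_ssubset hu) (Finset.mem_erase.2 hw.1.2)
      (Finset.mem_erase.2 ⟨huv.symm, hv⟩) hw.1.1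

lemma rayleigh_path (x : V → ℝ) {S : Finset V} (l : List V) (hl : l ≠ []) (u : V)
    (hc : (u :: l).IsChain G.Adj) (hn : (u :: l).Nodup) (hS : ∀ a ∈ u :: l, a ∈ S) :
    weightedMP G x (S \ (u :: l).toFinset) ^ 2 ≤ rayleigh G x S u (l.getLast hl) := by
  induction l generalizing u S with
  | nil => exact absurd rfl hl
  | cons w l ih =>
    have hu : u ∈ S := hS u (by simp)
    have hlast : (w :: l).getLast hl ∈ w :: l := List.getLast_mem hl
    have hne : u ≠ (w :: l).getLast hl := by
      intro h
      rw [← h] at hlast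
      exact (List.nodup_cons.1 hn).1 hlast
    have hadj : G.Adj u w := (List.isChain_cons_cons.1 hc).1
    have hwu : w ≠ u := hadj.ne'
    have hset : S \ (u :: w :: l).toFinset = S.erase u \ (w :: l).toFinset := by
      ext a
      simp only [Finset.mem_sdiff, List.mem_toFinset, List.mem_cons, Finset.mem_erase]
      tauto
    have hnn : ∀ b ∈ ((S.erase u).erase ((w :: l).getLast hl)).filter (G.Adj u),
        0 ≤ rayleigh G x (S.erase u) b ((w :: l).getLast hl) := by
      intro b hb
      simp only [Finset.mem_filter, Finset.mem_erase] at hb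
      exact rayleigh_nonneg x (Finset.mem_erase.2 hb.1.2)
        (Finset.mem_erase.2 ⟨hne.symm, hS _ (List.mem_cons_of_mem _ hlast)⟩) hb.1.1
    rw [rayleigh_recurrence x hu (hS _ (List.mem_cons_of_mem _ hlast)) hne]
    rcases eq_or_ne l [] with rfl | hl'
    · have h2 : S \ [u, w].toFinset = (S.erase u).erase w := by
        ext a
        simp only [Finset.mem_sdiff, List.mem_toFinset, List.mem_cons, Finset.mem_erase,
          List.not_mem_nil, or_false, not_or]
        tauto
      have hlw : [w].getLast hl = w := rfl
      rw [h2]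
      simp only [hlw] at hnn ⊢
      rw [if_pos hadj]
      exact le_add_of_nonneg_right (Finset.sum_nonneg hnn)
    · have hgl : (w :: l).getLast hl = l.getLast hl' := List.getLast_cons hl'
      have hwl : w ≠ l.getLast hl' := by
        intro h
        have := List.getLast_mem hl'
        rw [← h] at this
        exact (List.nodup_cons.1 (List.nodup_cons.1 hn).2).1 this
      have hstep := ih (S := S.erase u) hl' w (List.isChain_cons_cons.1 hc).2
        (List.nodup_cons.1 hn).2 (fun a ha => Finset.mem_erase.2
          ⟨fun h => (List.nodup_cons.1 hn).1 (h ▸ ha), hS a (List.mem_cons_of_mem _ ha)⟩)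
      rw [hset]
      rw [hgl] at hnn ⊢
      refine hstep.trans ((Finset.single_le_sum hnn ?_).trans (le_add_of_nonneg_left ?_))
      · simp only [Finset.mem_filter, Finset.mem_erase]
        exact ⟨⟨hwl, hwu, hS w (by simp)⟩, hadj⟩
      · split_ifs <;> positivity

end HeilmannLieb

/-! ### The matching polynomial of an induced subgraph -/

section Univariate

open scoped Classical Polynomial

open Polynomial

variable {V : Type*} (G : SimpleGraph V)

/-- The matching polynomial of the induced subgraph `G[S]`, over the reals. -/
noncomputable def mp (S : Finset V) : ℝ[X] := weightedMP G (fun _ => X) S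

variable {G}

lemma mp_recurrence {S : Finset V} {u : V} (hu : u ∈ S) :
    mp G S = X * mp G (S.erase u) -
      ∑ w ∈ S.erase u with G.Adj u w, mp G ((S.erase u).erase w) :=
  weightedMP_recurrence _ hu

lemma mp_empty : mp G ∅ = 1 := weightedMP_empty _

lemma mp_union (S T : Finset V) (hST : Disjoint S T) (hE : ∀ a ∈ S, ∀ b ∈ T, ¬ G.Adj a b) :
    mp G (S ∪ T) = mp G S * mp G T :=
  weightedMP_union _ S T hST hE

lemma mp_of_edgeless {S : Finset V} (h : ∀ a ∈ S, ∀ b ∈ S, ¬ G.Adj a b) :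
    mp G S = X ^ S.card := by
  rw [mp, weightedMP_of_edgeless _ h, Finset.prod_const]

lemma eval_mp (S : Finset V) (t : ℝ) : (mp G S).eval t = weightedMP G (fun _ => t) S := by
  have := map_weightedMP (G := G) (Polynomial.evalRingHom t) (fun _ => X) S
  simpa [mp] using this

lemma mp_monic_and_natDegree (S : Finset V) :
    (mp G S).Monic ∧ (mp G S).natDegree = S.card := by
  induction S using Finset.strongInduction with
  | H S ih =>
    rcases S.eq_empty_or_nonempty with rfl | ⟨u, hu⟩
    · simp [mp_empty]
    obtain ⟨hm, hd⟩ := ih _ (Finset.erase_ssubset hu)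
    have hcard := Finset.card_erase_add_one hu
    have hm' : (X * mp G (S.erase u)).Monic := monic_X.mul hm
    have hd' : (X * mp G (S.erase u)).natDegree = S.card := by
      rw [monic_X.natDegree_mul hm, natDegree_X, hd]
      omega
    have hlt : (∑ w ∈ S.erase u with G.Adj u w, mp G ((S.erase u).erase w)).degree <
        (X * mp G (S.erase u)).degree := by
      rw [degree_eq_natDegree hm'.ne_zero, hd']
      refine lt_of_le_of_lt (degree_sum_le _ _) ?_
      rw [Finset.sup_lt_iff (WithBot.bot_lt_coe _)]
      intro w hw
      have hw' := (Finset.mem_filter.1 hw).1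
      obtain ⟨hmw, hdw⟩ := ih _ ((Finset.erase_ssubset hw').trans (Finset.erase_ssubset hu))
      rw [degree_eq_natDegree hmw.ne_zero, hdw]
      have := Finset.card_erase_add_one hw'
      exact_mod_cast (by omega : ((S.erase u).erase w).card < S.card)
    rw [mp_recurrence hu]
    exact ⟨hm'.sub_of_left hlt,
      (natDegree_eq_of_degree_eq (degree_sub_eq_left_of_degree_lt hlt)).trans hd'⟩

lemma mp_monic (S : Finset V) : (mp G S).Monic := (mp_monic_and_natDegree S).1

lemma mp_ne_zero (S : Finset V) : mp G S ≠ 0 := (mp_monic S).ne_zero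

lemma natDegree_mp (S : Finset V) : (mp G S).natDegree = S.card := (mp_monic_and_natDegree S).2

lemma mp_comp_neg_X (S : Finset V) : (mp G S).comp (-X) = (-1) ^ S.card * mp G S := by
  have := map_weightedMP (G := G) (Polynomial.compRingHom (-X : ℝ[X])) (fun _ => X) S
  rw [coe_compRingHom_apply] at this
  rw [mp, this, ← weightedMP_neg]
  simp

lemma derivative_mp (S : Finset V) : derivative (mp G S) = ∑ v ∈ S, mp G (S.erase v) := by
  induction S using Finset.strongInduction with
  | H S ih =>
    rcases S.eq_empty_or_nonempty with rfl | ⟨u, hu⟩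
    · simp [mp_empty]
    have hss : ∀ w ∈ (S.erase u).filter (G.Adj u), (S.erase u).erase w ⊂ S := fun w hw =>
      (Finset.erase_ssubset (Finset.mem_filter.1 hw).1).trans (Finset.erase_ssubset hu)
    have h1 : derivative (mp G S) = mp G (S.erase u) + (X * ∑ v ∈ S.erase u,
        mp G ((S.erase u).erase v) - ∑ w ∈ S.erase u with G.Adj u w,
          ∑ v ∈ (S.erase u).erase w, mp G (((S.erase u).erase w).erase v)) := by
      rw [mp_recurrence hu, derivative_sub, derivative_mul, derivative_X, one_mul,
        ih _ (Finset.erase_ssubset hu), derivative_sum, add_sub_assoc]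
      congr 2
      exact Finset.sum_congr rfl fun w hw => ih _ (hss w hw)
    have h2 : ∀ v ∈ S.erase u, mp G (S.erase v) = X * mp G ((S.erase u).erase v) -
        ∑ w ∈ (S.erase u).erase v with G.Adj u w, mp G (((S.erase u).erase v).erase w) := by
      intro v hv
      have huv : u ∈ S.erase v :=
        Finset.mem_erase.2 ⟨(Finset.mem_erase.1 hv).1.symm, hu⟩
      rw [mp_recurrence huv, Finset.erase_right_comm]
    rw [h1, ← Finset.add_sum_erase _ _ hu, Finset.sum_congr rfl h2, Finset.sum_sub_distrib,
      ← Finset.mul_sum]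
    congr 2
    refine (Finset.sum_comm' (t' := S.erase u)
      (s' := fun v => ((S.erase u).erase v).filter (G.Adj u)) ?_).trans ?_
    · intro w v
      simp only [Finset.mem_filter, Finset.mem_erase]
      tauto
    · exact Finset.sum_congr rfl fun v _ => Finset.sum_congr rfl fun w _ => by
        rw [Finset.erase_right_comm]

end Univariate

/-! ### Real-rootedness and multiplicities -/

section RealRooted

open scoped Classical Polynomial

open Polynomial

variable {V : Type*} {G : SimpleGraph V}

/-- For `z` in the upper half plane the quotient `F(S) / F(S - u)` lies in the upper half plane; in
particular `F(S)` does not vanish at `z`. -/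
lemma weightedMP_upperHalfPlane {z : ℂ} (hz : 0 < z.im) (S : Finset V) :
    weightedMP G (fun _ => z) S ≠ 0 ∧ ∀ u ∈ S,
      0 < (weightedMP G (fun _ => z) S / weightedMP G (fun _ => z) (S.erase u)).im := by
  induction S using Finset.strongInduction with
  | H S ih =>
    have key : ∀ u ∈ S,
        0 < (weightedMP G (fun _ => z) S / weightedMP G (fun _ => z) (S.erase u)).im := by
      intro u hu
      obtain ⟨h0, h1⟩ := ih _ (Finset.erase_ssubset hu)
      rw [weightedMP_recurrence _ hu, sub_div, mul_div_cancel_right₀ _ h0, Finset.sum_div,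
        Complex.sub_im, Complex.im_sum]
      have : ∑ w ∈ S.erase u with G.Adj u w, (weightedMP G (fun _ => z) ((S.erase u).erase w) /
          weightedMP G (fun _ => z) (S.erase u)).im ≤ 0 := by
        refine Finset.sum_nonpos fun w hw => ?_
        have := h1 w (Finset.mem_filter.1 hw).1
        rw [← inv_div, Complex.inv_im]
        exact div_nonpos_of_nonpos_of_nonneg (by linarith) (Complex.normSq_nonneg _)
      linarith
    refine ⟨?_, key⟩
    rcases S.eq_empty_or_nonempty with rfl | ⟨u, hu⟩
    · simp [weightedMP_empty]
    · intro h
      have := key u hu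
      simp [h] at this

lemma eval_map_mp (S : Finset V) (z : ℂ) :
    ((mp G S).map (algebraMap ℝ ℂ)).eval z = weightedMP G (fun _ => z) S := by
  have := map_weightedMP (G := G) (Polynomial.eval₂RingHom (algebraMap ℝ ℂ) z) (fun _ => X) S
  rw [eval_map]
  simpa [mp] using this

lemma im_eq_zero_of_root {S : Finset V} {z : ℂ}
    (h : ((mp G S).map (algebraMap ℝ ℂ)).eval z = 0) : z.im = 0 := by
  rw [eval_map_mp] at h
  rcases lt_trichotomy z.im 0 with hz | hz | hz
  · have h2 := (weightedMP_upperHalfPlane (G := G) (z := -z) (by simpa using hz) S).1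
    rw [weightedMP_neg (fun _ => z), h, mul_zero] at h2
    exact absurd rfl h2
  · exact hz
  · exact absurd h (weightedMP_upperHalfPlane hz S).1

lemma mp_splits (S : Finset V) : (mp G S).Splits := by
  refine Splits.of_splits_map (algebraMap ℝ ℂ) (IsAlgClosed.splits _) fun z hz => ?_
  have h := im_eq_zero_of_root ((mem_roots'.1 hz).2 : _ = _)
  exact ⟨z.re, Complex.ext rfl (by simp [h])⟩

/-- The finite set of roots of the matching polynomial of `G[S]`. -/
noncomputable def mroots (G : SimpleGraph V) (S : Finset V) : Finset ℝ := (mp G S).roots.toFinset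

/-- The multiplicity of `θ` as a root of the matching polynomial of `G[S]`. -/
noncomputable def mmult (G : SimpleGraph V) (θ : ℝ) (S : Finset V) : ℕ :=
  (mp G S).rootMultiplicity θ

lemma mem_mroots {S : Finset V} {θ : ℝ} : θ ∈ mroots G S ↔ 0 < mmult G θ S := by
  rw [mroots, mmult, Multiset.mem_toFinset, ← count_roots, Multiset.count_pos]

lemma sum_mmult (S : Finset V) : ∑ θ ∈ mroots G S, mmult G θ S = S.card := by
  have h1 := (mp_splits (G := G) S).natDegree_eq_card_roots
  rw [natDegree_mp] at h1
  rw [h1, mroots, ← Multiset.toFinset_sum_count_eq]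
  exact Finset.sum_congr rfl fun θ _ => (count_roots _).symm

lemma mmult_neg (θ : ℝ) (S : Finset V) : mmult G (-θ) S = mmult G θ S := by
  have h := rootMultiplicity_comp_C_mul_X_add_C (mp G S) (-1) 0 θ (by simp)
  have h2 : (C (-1) * X + C 0 : ℝ[X]) = -X := by simp
  have h3 : ((-1 : ℝ[X]) ^ S.card * mp G S) = C ((-1) ^ S.card) * mp G S := by simp
  have h4 : C ((-1 : ℝ) ^ S.card) * mp G S ≠ 0 :=
    mul_ne_zero (C_ne_zero.2 (by simp)) (mp_ne_zero S)
  rw [h2, mp_comp_neg_X, h3, rootMultiplicity_mul h4, rootMultiplicity_C, zero_add] at h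
  simpa [mmult] using h.symm

lemma neg_mem_mroots {S : Finset V} {θ : ℝ} (h : θ ∈ mroots G S) : -θ ∈ mroots G S := by
  rw [mem_mroots, mmult_neg]
  exact mem_mroots.1 h

/-- Sums of even functions over the symmetric set of matching roots. -/
lemma sum_mroots_even (S : Finset V) (f : ℝ → ℕ) (hf : ∀ θ, f (-θ) = f θ) :
    ∑ θ ∈ mroots G S, f θ =
      2 * ∑ θ ∈ mroots G S with 0 < θ, f θ + if (0 : ℝ) ∈ mroots G S then f 0 else 0 := by
  have h1 : ∑ θ ∈ mroots G S with θ < 0, f θ = ∑ θ ∈ mroots G S with 0 < θ, f θ := by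
    refine Finset.sum_bij (fun θ _ => -θ) ?_ ?_ ?_ ?_
    · intro θ hθ
      rw [Finset.mem_filter] at hθ ⊢
      exact ⟨neg_mem_mroots hθ.1, by linarith [hθ.2]⟩
    · intro a _ b _ h
      exact neg_injective h
    · intro θ hθ
      rw [Finset.mem_filter] at hθ
      exact ⟨-θ, Finset.mem_filter.2 ⟨neg_mem_mroots hθ.1, by linarith [hθ.2]⟩, by simp⟩
    · intro θ _
      exact (hf θ).symm
  have h2 : ∑ θ ∈ mroots G S with ¬ 0 < θ, f θ =
      ∑ θ ∈ mroots G S with θ < 0, f θ + if (0 : ℝ) ∈ mroots G S then f 0 else 0 := by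
    rw [← Finset.sum_ite_eq' (mroots G S) 0 f, ← Finset.sum_filter, Finset.sum_filter,
      Finset.sum_filter, Finset.sum_filter, ← Finset.sum_add_distrib]
    refine Finset.sum_congr rfl fun θ _ => ?_
    rcases lt_trichotomy θ 0 with h | h | h
    · simp [h, h.ne, h.le]
    · simp [h]
    · simp [h, h.ne', h.le]
  rw [← Finset.sum_filter_add_sum_filter_not _ (fun θ : ℝ => 0 < θ), h2, h1]
  ring

end RealRooted

/-! ### Comparison with the matching polynomial of the whole graph -/

section Bridge

open scoped Classical Polynomial

open Polynomial

variable {V : Type*} [Fintype V] (G : SimpleGraph V)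

variable {G} in
lemma card_uncovered_add {M : Finset (Sym2 V)} (hM : IsEdgeMatching G M) :
    (Finset.univ.filter fun v => ∀ e ∈ M, v ∉ e).card + 2 * M.card = Fintype.card V := by
  have h1 : (Finset.univ.filter fun v => ¬ ∀ e ∈ M, v ∉ e) = M.biUnion Sym2.toFinset := by
    ext v
    simp
  have h2 : (M.biUnion Sym2.toFinset).card = 2 * M.card := by
    rw [Finset.card_biUnion, Finset.sum_congr rfl
      (fun e he => Sym2.card_toFinset_of_not_isDiag e (G.not_isDiag_of_mem_edgeSet (hM.1 e he))),
      Finset.sum_const, smul_eq_mul, mul_comm]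
    intro e he f hf hne
    rw [Function.onFun, Finset.disjoint_left]
    intro v hv hv'
    exact hM.2 e he f hf hne v (Sym2.mem_toFinset.1 hv) (Sym2.mem_toFinset.1 hv')
  rw [← h2, ← h1, Finset.card_filter_add_card_filter_not, Finset.card_univ]

lemma map_matchingPoly : (matchingPoly G).map (Int.castRingHom ℝ) = mp G Finset.univ := by
  have hmem : ∀ M, M ∈ matchingsIn G Finset.univ ↔ IsEdgeMatching G M := by
    intro M
    simp [mem_matchingsIn]
  have hnum : ∀ k, (numMatchings G k : ℕ) =
      ((matchingsIn G Finset.univ).filter fun M => M.card = k).card := by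
    intro k
    rw [numMatchings, ← Set.ncard_coe_finset]
    congr 1
    ext M
    simp [hmem]
  have hmaps : ∀ M ∈ matchingsIn G Finset.univ,
      M.card ∈ Finset.range (Fintype.card V / 2 + 1) := by
    intro M hM
    have := card_uncovered_add ((hmem M).1 hM)
    rw [Finset.mem_range]
    omega
  rw [matchingPoly, mp, weightedMP, ← Finset.sum_fiberwise_of_maps_to hmaps, Polynomial.map_sum]
  refine Finset.sum_congr rfl fun k _ => ?_
  have hterm : ∀ M ∈ (matchingsIn G Finset.univ).filter (fun M => M.card = k),
      (Finset.univ.filter fun v => ∀ e ∈ M, v ∉ e).card = Fintype.card V - 2 * k := by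
    intro M hM
    obtain ⟨hM', rfl⟩ := Finset.mem_filter.1 hM
    rw [← card_uncovered_add ((hmem M).1 hM'), Nat.add_sub_cancel]
  rw [Finset.sum_congr rfl (g := fun _ => (-1) ^ k * X ^ (Fintype.card V - 2 * k)) fun M hM => ?_]
  swap
  · rw [Finset.prod_const, (Finset.mem_filter.1 hM).2, ← hterm M hM]
    congr!
  rw [Finset.sum_const, hnum]
  simp
  ring

/-- All complex matching roots are real, so they are counted by `mroots`. -/
lemma numMatchingRoots_eq : numMatchingRoots G = (mroots G Finset.univ).card := by
  have h1 : (matchingPoly G).map (algebraMap ℤ ℂ) =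
      (mp G Finset.univ).map (algebraMap ℝ ℂ) := by
    rw [← map_matchingPoly, Polynomial.map_map]
    congr 1
  have h2 : (matchingPoly G).rootSet ℂ = (fun t : ℝ => (t : ℂ)) '' (mroots G Finset.univ) := by
    ext z
    have hne : (mp G (Finset.univ : Finset V)).map (algebraMap ℝ ℂ) ≠ 0 :=
      (mp_monic _).map _ |>.ne_zero
    rw [rootSet, aroots, h1]
    simp only [Finset.mem_coe, Multiset.mem_toFinset, mem_roots hne, IsRoot.def, Set.mem_image,
      mroots, mem_roots (mp_ne_zero _)]
    have hev : ∀ t : ℝ, ((mp G (Finset.univ : Finset V)).map (algebraMap ℝ ℂ)).eval (t : ℂ) =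
        (((mp G Finset.univ).eval t : ℝ) : ℂ) := fun t => eval_map_apply (algebraMap ℝ ℂ) t
    constructor
    · intro h
      have him := im_eq_zero_of_root h
      have hz : ((z.re : ℝ) : ℂ) = z := Complex.ext rfl (by simp [him])
      refine ⟨z.re, ?_, hz⟩
      rw [← hz, hev] at h
      exact_mod_cast h
    · rintro ⟨t, ht, rfl⟩
      rw [hev, ht]
      simp
  rw [numMatchingRoots, h2, Set.ncard_image_of_injective _ Complex.ofReal_injective,
    Set.ncard_coe_finset]

end Bridge

/-! ### Orders of vanishing of real polynomials -/

section Order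

open Polynomial Filter Topology

lemma eval_le_of_eventually {p q : ℝ[X]} {θ : ℝ} (h : ∀ t, t ≠ θ → p.eval t ≤ q.eval t) :
    p.eval θ ≤ q.eval θ := by
  refine le_of_tendsto_of_tendsto (b := 𝓝[≠] θ)
    (p.continuous.tendsto θ |>.mono_left nhdsWithin_le_nhds)
    (q.continuous.tendsto θ |>.mono_left nhdsWithin_le_nhds) ?_
  filter_upwards [self_mem_nhdsWithin] with t ht using h t ht

lemma exists_eq_pow_mul {p : ℝ[X]} (hp : p ≠ 0) (θ : ℝ) :
    ∃ r : ℝ[X], p = (X - C θ) ^ p.rootMultiplicity θ * r ∧ r.eval θ ≠ 0 := by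
  obtain ⟨r, hr, hr'⟩ := exists_eq_pow_rootMultiplicity_mul_and_not_dvd p hp θ
  exact ⟨r, hr, fun h => hr' (dvd_iff_isRoot.2 h)⟩

/-- A polynomial that dominates `p²` on the real line vanishes at `θ` at most twice as often
as `p`. -/
lemma le_two_mul_rootMultiplicity {p q : ℝ[X]} {θ : ℝ} {b : ℕ} (hp : p ≠ 0)
    (hpq : ∀ t, p.eval t ^ 2 ≤ q.eval t) (hb : (X - C θ) ^ b ∣ q) :
    b ≤ 2 * p.rootMultiplicity θ := by
  by_contra! hlt
  obtain ⟨p₁, hp₁, hne⟩ := exists_eq_pow_mul hp θ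
  obtain ⟨q₁, hq₁⟩ := (pow_dvd_pow (X - C θ) hlt).trans hb
  set a := p.rootMultiplicity θ
  have h : ∀ t, t ≠ θ → (p₁ ^ 2).eval t ≤ ((X - C θ) * q₁).eval t := by
    intro t ht
    have h1 := hpq t
    rw [hp₁, hq₁] at h1
    simp only [eval_mul, eval_pow, eval_sub, eval_X, eval_C] at h1 ⊢
    have h2 : 0 < (t - θ) ^ (2 * a) := by
      rw [pow_mul]
      have : t - θ ≠ 0 := sub_ne_zero.2 ht
      positivity
    refine le_of_mul_le_mul_left ?_ h2
    calc (t - θ) ^ (2 * a) * p₁.eval t ^ 2 = ((t - θ) ^ a * p₁.eval t) ^ 2 := by ring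
      _ ≤ _ := h1
      _ = _ := by rw [Nat.succ_eq_add_one]; ring
  have := eval_le_of_eventually h
  simp only [eval_pow, eval_mul, eval_sub, eval_X, eval_C, sub_self, zero_mul] at this
  exact hne (pow_eq_zero_iff two_ne_zero |>.1 (le_antisymm this (sq_nonneg _)))

lemma even_rootMultiplicity_of_nonneg {q : ℝ[X]} {θ : ℝ} (hq : q ≠ 0)
    (h0 : ∀ t, 0 ≤ q.eval t) : Even (q.rootMultiplicity θ) := by
  by_contra hodd
  obtain ⟨a, ha⟩ := Nat.not_even_iff_odd.1 hodd
  obtain ⟨r, hr, hne⟩ := exists_eq_pow_mul hq θ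
  rw [ha] at hr
  have h : ∀ t, 0 ≤ (t - θ) * r.eval t := by
    intro t
    rcases eq_or_ne t θ with rfl | ht
    · simp
    have h1 := h0 t
    rw [hr] at h1
    simp only [eval_mul, eval_pow, eval_sub, eval_X, eval_C] at h1
    have h2 : 0 < (t - θ) ^ (2 * a) := by
      rw [pow_mul]
      have : t - θ ≠ 0 := sub_ne_zero.2 ht
      positivity
    rw [pow_succ, mul_assoc] at h1
    exact nonneg_of_mul_nonneg_right h1 h2
  have hmin : IsLocalMin (fun t => ((X - C θ) * r).eval t) θ :=
    Filter.Eventually.of_forall fun t => by simpa using h t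
  have := hmin.hasDerivAt_eq_zero (((X - C θ) * r).hasDerivAt θ)
  simp at this
  exact hne this

lemma rootMultiplicity_sub_of_lt {p q : ℝ[X]} {θ : ℝ} (hp : p ≠ 0)
    (hq : (X - C θ) ^ (p.rootMultiplicity θ + 1) ∣ q) :
    p - q ≠ 0 ∧ (p - q).rootMultiplicity θ = p.rootMultiplicity θ := by
  have hnd : ¬ (X - C θ) ^ (p.rootMultiplicity θ + 1) ∣ p - q := fun h =>
    pow_rootMultiplicity_not_dvd hp θ ((dvd_sub_left hq).1 h)
  have hne : p - q ≠ 0 := fun h => hnd (h ▸ dvd_zero _)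
  refine ⟨hne, le_antisymm ?_ ?_⟩
  · exact (rootMultiplicity_le_iff hne _ _).2 hnd
  · exact (le_rootMultiplicity_iff hne).2 (dvd_sub (pow_rootMultiplicity_dvd _ _)
      ((pow_dvd_pow _ (Nat.le_succ _)).trans hq))

end Order

/-! ### Interlacing and the path bound -/

section Interlacing

open scoped Classical Polynomial

open Polynomial

variable {V : Type*} {G : SimpleGraph V} {θ : ℝ}

lemma pow_dvd_mp {S : Finset V} {k : ℕ} : (X - C θ) ^ k ∣ mp G S ↔ k ≤ mmult G θ S :=
  (le_rootMultiplicity_iff (mp_ne_zero S)).symm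

lemma pow_dvd_mp_mul_mp {S T : Finset V} {k : ℕ} (h : k ≤ mmult G θ S + mmult G θ T) :
    (X - C θ) ^ k ∣ mp G S * mp G T := by
  refine (pow_dvd_pow _ h).trans ?_
  rw [pow_add]
  exact mul_dvd_mul (pow_dvd_mp.2 le_rfl) (pow_dvd_mp.2 le_rfl)

lemma rootMultiplicity_mp_mul_mp (S T : Finset V) :
    (mp G S * mp G T).rootMultiplicity θ = mmult G θ S + mmult G θ T :=
  rootMultiplicity_mul (mul_ne_zero (mp_ne_zero S) (mp_ne_zero T))

lemma eval_rayleigh (S : Finset V) (u v : V) (t : ℝ) :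
    (rayleigh G (fun _ => (X : ℝ[X])) S u v).eval t = rayleigh G (fun _ => t) S u v := by
  simp only [rayleigh, eval_sub, eval_mul]
  change (mp G _).eval t * (mp G _).eval t - (mp G _).eval t * (mp G _).eval t = _
  simp only [eval_mp]

/-- The Wronskian of `F(S - u)` and `F(S)` dominates `F(S - u)²`. -/
lemma sq_le_wronskian {S : Finset V} {u : V} (hu : u ∈ S) (t : ℝ) :
    (mp G (S.erase u)).eval t ^ 2 ≤ (mp G (S.erase u) * derivative (mp G S) -
      mp G S * derivative (mp G (S.erase u))).eval t := by
  have h : mp G (S.erase u) * derivative (mp G S) - mp G S * derivative (mp G (S.erase u)) =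
      mp G (S.erase u) ^ 2 + ∑ v ∈ S.erase u, rayleigh G (fun _ => X) S u v := by
    rw [derivative_mp, derivative_mp, ← Finset.add_sum_erase _ _ hu]
    simp only [rayleigh, Finset.sum_sub_distrib, ← Finset.mul_sum, mp]
    ring
  rw [h, eval_add, eval_pow, eval_finsetSum]
  refine le_add_of_nonneg_right (Finset.sum_nonneg fun v hv => ?_)
  rw [eval_rayleigh]
  obtain ⟨hvu, hv⟩ := Finset.mem_erase.1 hv
  exact rayleigh_nonneg _ hu hv hvu.symm

lemma mmult_le_erase {S : Finset V} {u : V} (hu : u ∈ S) :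
    mmult G θ S ≤ mmult G θ (S.erase u) + 1 := by
  rcases Nat.eq_zero_or_pos (mmult G θ S) with h0 | hpos
  · omega
  -- The Wronskian has order at least `m(S - u) + m(S) - 1`, and it dominates `F(S - u)²`.
  have h1 : (X - C θ) ^ (mmult G θ (S.erase u) + mmult G θ S - 1) ∣
      mp G (S.erase u) * derivative (mp G S) - mp G S * derivative (mp G (S.erase u)) := by
    refine dvd_sub ?_ ?_
    · rw [Nat.add_sub_assoc hpos, pow_add]
      exact mul_dvd_mul (pow_dvd_mp.2 le_rfl)
        (pow_sub_one_dvd_derivative_of_pow_dvd (pow_dvd_mp.2 le_rfl))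
    · refine (pow_dvd_pow _ (by omega :
        _ ≤ mmult G θ S + (mmult G θ (S.erase u) - 1))).trans ?_
      rw [pow_add]
      exact mul_dvd_mul (pow_dvd_mp.2 le_rfl)
        (pow_sub_one_dvd_derivative_of_pow_dvd (pow_dvd_mp.2 le_rfl))
  have h2 := le_two_mul_rootMultiplicity (mp_ne_zero _) (sq_le_wronskian (G := G) hu) h1
  change _ ≤ 2 * mmult G θ (S.erase u) at h2
  omega

lemma mmult_erase_le {S : Finset V} {u : V} (hu : u ∈ S) :
    mmult G θ (S.erase u) ≤ mmult G θ S + 1 := by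
  suffices h : mmult G θ (S.erase u) - 1 ≤ mmult G θ S by omega
  rw [← pow_dvd_mp, mp_recurrence hu]
  refine dvd_sub ((pow_dvd_mp.2 (Nat.sub_le _ _)).mul_left _) (Finset.dvd_sum fun w hw => ?_)
  rw [pow_dvd_mp]
  have := mmult_le_erase (G := G) (θ := θ) (Finset.mem_filter.1 hw).1
  omega

/-- Deleting a path `P` from `u` to `v` lowers the multiplicity of a root by at most one: the Rayleigh
difference for `u, v` has order at least `2 m(S) - 2` and dominates `F(S - P)²`. -/
lemma mmult_le_sdiff_path {S : Finset V} (u : V) (l : List V) (hc : (u :: l).IsChain G.Adj)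
    (hn : (u :: l).Nodup) (hS : ∀ a ∈ u :: l, a ∈ S) :
    mmult G θ S ≤ mmult G θ (S \ (u :: l).toFinset) + 1 := by
  have hu : u ∈ S := hS u (by simp)
  rcases eq_or_ne l [] with rfl | hl
  · have : S \ [u].toFinset = S.erase u := by
      ext a
      simp [and_comm]
    rw [this]
    exact mmult_le_erase hu
  have hlast := List.getLast_mem hl
  set v := l.getLast hl with hv
  have hvS : v ∈ S := hS v (List.mem_cons_of_mem _ hlast)
  have huv : u ≠ v := by
    intro h
    rw [← h] at hlast
    exact (List.nodup_cons.1 hn).1 hlast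
  have h1 := mmult_le_erase (G := G) (θ := θ) hu
  have h2 := mmult_le_erase (G := G) (θ := θ) hvS
  have h3 := mmult_le_erase (G := G) (θ := θ) (Finset.mem_erase.2 ⟨huv.symm, hvS⟩)
  have hd : (X - C θ) ^ (2 * mmult G θ S - 2) ∣ rayleigh G (fun _ => (X : ℝ[X])) S u v := by
    refine dvd_sub (pow_dvd_mp_mul_mp ?_) (pow_dvd_mp_mul_mp ?_) <;> omega
  have h4 := le_two_mul_rootMultiplicity (mp_ne_zero (G := G) (S \ (u :: l).toFinset))
    (fun t => by
      rw [eval_rayleigh, eval_mp]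
      exact rayleigh_path _ l hl u hc hn hS) hd
  change _ ≤ 2 * mmult G θ _ at h4
  omega

lemma mmult_le_erase_edge {S : Finset V} {u v : V} (hu : u ∈ S) (hv : v ∈ S)
    (h : G.Adj u v) : mmult G θ S ≤ mmult G θ ((S.erase u).erase v) + 1 := by
  have h1 := mmult_le_sdiff_path (G := G) (θ := θ) (S := S) u [v] (by simpa using h)
    (by simpa using h.ne) (by simp [hu, hv])
  have h2 : S \ [u, v].toFinset = (S.erase u).erase v := by
    ext a
    simp only [Finset.mem_sdiff, List.mem_toFinset, List.mem_cons, Finset.mem_erase,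
      List.not_mem_nil, or_false, not_or]
    tauto
  rwa [h2] at h1

lemma sum_mmult_le (A : Finset ℝ) (S : Finset V) : ∑ θ ∈ A, mmult G θ S ≤ S.card := by
  rw [← sum_mmult (G := G) S]
  refine Finset.sum_le_sum_of_ne_zero fun θ _ h => ?_
  exact mem_mroots.2 (Nat.pos_of_ne_zero h)

/-- A path `P` has at most as many vertices as there are distinct matching roots: the degree of
`F(S - P)` is at least the sum of `m(S) - 1` over all roots. -/
theorem length_le_card_mroots {S : Finset V} (l : List V) (hc : l.IsChain G.Adj)
    (hn : l.Nodup) (hS : ∀ a ∈ l, a ∈ S) : l.length ≤ (mroots G S).card := by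
  rcases l with _ | ⟨u, l⟩
  · simp
  have h1 : S.card ≤ (S \ (u :: l).toFinset).card + (mroots G S).card := by
    rw [← sum_mmult (G := G) S, Finset.card_eq_sum_ones (mroots G S)]
    refine le_trans (Finset.sum_le_sum fun θ _ =>
      mmult_le_sdiff_path (G := G) (θ := θ) u l hc hn hS) ?_
    rw [Finset.sum_add_distrib]
    exact Nat.add_le_add_right (sum_mmult_le _ _) _
  have hsub : (u :: l).toFinset ⊆ S := fun a ha => hS a (List.mem_toFinset.1 ha)
  have h2 := Finset.card_sdiff_add_card_eq_card hsub
  rw [List.toFinset_card_of_nodup hn] at h2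
  omega

end Interlacing

/-! ### Gallai's lemma for matching roots -/

section Gallai

open scoped Classical Polynomial

open Polynomial

variable {V : Type*} {G : SimpleGraph V} {θ : ℝ}

lemma exists_essential {S : Finset V} (h : 0 < mmult G θ S) :
    ∃ u ∈ S, mmult G θ (S.erase u) + 1 = mmult G θ S := by
  by_contra! hno
  have h1 : ∀ u ∈ S, mmult G θ S ≤ mmult G θ (S.erase u) := by
    intro u hu
    have := mmult_le_erase (G := G) (θ := θ) hu
    have := hno u hu
    omega
  have h2 : (X - C θ) ^ mmult G θ S ∣ derivative (mp G S) := by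
    rw [derivative_mp]
    exact Finset.dvd_sum fun u hu => pow_dvd_mp.2 (h1 u hu)
  have hroot : (mp G S).IsRoot θ := (rootMultiplicity_pos (mp_ne_zero S)).1 h
  have h3 := derivative_rootMultiplicity_of_root hroot
  have h4 : derivative (mp G S) ≠ 0 := by
    intro h0
    have := derivative_eq_zero.1 h0
    rw [natDegree_mp] at this
    have hS := sum_mmult_le (G := G) {θ} S
    rw [Finset.sum_singleton] at hS
    omega
  have h5 := (le_rootMultiplicity_iff h4).2 h2
  change _ = mmult G θ S - 1 at h3
  omega

/-- If deleting `u` lowers the multiplicity of `θ`, then deleting a neighbour of `u` changes it. -/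
lemma mmult_erase_ne_of_adj {S : Finset V} {u v : V} (hu : u ∈ S) (hv : v ∈ S)
    (huv : G.Adj u v) (hess : mmult G θ (S.erase u) + 1 = mmult G θ S) :
    mmult G θ (S.erase v) ≠ mmult G θ S := by
  intro hneut
  have hk := mmult_le_erase_edge (θ := θ) hu hv huv
  -- The Rayleigh difference dominates `F(S - u - v)²` and has even order. Its order would be at least
  -- `2 m - 1 > 2 m(S - u - v)` if `m(S - u - v) = m - 1`, and exactly `2 m - 1` otherwise.
  rcases (by omega : mmult G θ S = mmult G θ ((S.erase u).erase v) + 1 ∨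
      mmult G θ S ≤ mmult G θ ((S.erase u).erase v)) with h | h
  · have hd : (X - C θ) ^ (2 * mmult G θ S - 1) ∣ rayleigh G (fun _ => (X : ℝ[X])) S u v := by
      refine dvd_sub (pow_dvd_mp_mul_mp ?_) (pow_dvd_mp_mul_mp ?_) <;> omega
    have h4 := le_two_mul_rootMultiplicity (mp_ne_zero (G := G) ((S.erase u).erase v))
      (fun t => by
        rw [eval_rayleigh, eval_mp, rayleigh_recurrence _ hu hv huv.ne, if_pos huv]
        refine le_add_of_nonneg_right (Finset.sum_nonneg fun w hw => ?_)
        simp only [Finset.mem_filter, Finset.mem_erase] at hw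
        exact rayleigh_nonneg _ (Finset.mem_erase.2 hw.1.2)
          (Finset.mem_erase.2 ⟨huv.ne', hv⟩) hw.1.1) hd
    change _ ≤ 2 * mmult G θ _ at h4
    omega
  · obtain ⟨hne, hm⟩ := rootMultiplicity_sub_of_lt (θ := θ)
      (mul_ne_zero (mp_ne_zero (G := G) (S.erase u)) (mp_ne_zero (S.erase v)))
      (q := mp G S * mp G ((S.erase u).erase v)) (by
        rw [rootMultiplicity_mp_mul_mp]
        exact pow_dvd_mp_mul_mp (by omega))
    have heven := even_rootMultiplicity_of_nonneg (θ := θ) hne fun t => by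
      change 0 ≤ (rayleigh G (fun _ => (X : ℝ[X])) S u v).eval t
      rw [eval_rayleigh]
      exact rayleigh_nonneg _ hu hv huv.ne
    rw [hm, rootMultiplicity_mp_mul_mp, hneut, ← hess, Nat.even_iff] at heven
    omega

/-- On the vertices whose deletion lowers the multiplicity of `θ`, the relation "deleting both
lowers the multiplicity only once" is transitive. If it failed, the Rayleigh difference for `u, v`,
as a quadratic polynomial in a perturbation of the weight of `w`, would have a discriminant of too
small an order at `θ` to be nonpositive. -/
lemma essential_trans {S : Finset V} {u v w : V} (hu : u ∈ S) (hv : v ∈ S) (hw : w ∈ S)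
    (huv : u ≠ v) (hvw : v ≠ w) (huw : u ≠ w)
    (eu : mmult G θ (S.erase u) + 1 = mmult G θ S)
    (ev : mmult G θ (S.erase v) + 1 = mmult G θ S)
    (ew : mmult G θ (S.erase w) + 1 = mmult G θ S)
    (h1 : mmult G θ S ≤ mmult G θ ((S.erase u).erase v) + 1)
    (h2 : mmult G θ S ≤ mmult G θ ((S.erase v).erase w) + 1) :
    mmult G θ S ≤ mmult G θ ((S.erase u).erase w) + 1 := by
  by_contra! hlt
  have h3 := mmult_le_erase (G := G) (θ := θ) (S := S.erase u) (u := w)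
    (Finset.mem_erase.2 ⟨huw.symm, hw⟩)
  have h4 := mmult_le_erase (G := G) (θ := θ) (S := (S.erase u).erase v) (u := w)
    (Finset.mem_erase.2 ⟨hvw.symm, Finset.mem_erase.2 ⟨huw.symm, hw⟩⟩)
  obtain ⟨k, hk⟩ : ∃ k, mmult G θ ((S.erase u).erase w) = k := ⟨_, rfl⟩
  -- With the weight of `w` raised by `s` the Rayleigh difference for `u, v` is `A + B s + D s²`,
  -- where `B = F(S - u - w) F(S - v) - B'`. At `θ` the order of `B` is exactly `2 k + 1`, while the
  -- orders of `A` and `D` are at least `2 k + 2` and `2 k + 1`; this contradicts `B² ≤ 4 A D`.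
  set A : ℝ[X] := mp G (S.erase u) * mp G (S.erase v) - mp G S * mp G ((S.erase u).erase v)
    with hA
  set D : ℝ[X] := mp G ((S.erase u).erase w) * mp G ((S.erase v).erase w) -
    mp G (S.erase w) * mp G (((S.erase u).erase v).erase w) with hD
  set B' : ℝ[X] := mp G S * mp G (((S.erase u).erase v).erase w) +
    mp G (S.erase w) * mp G ((S.erase u).erase v) -
    mp G (S.erase u) * mp G ((S.erase v).erase w) with hB'
  have hA_dvd : (X - C θ) ^ (2 * k + 2) ∣ A := by
    refine dvd_sub (pow_dvd_mp_mul_mp ?_) (pow_dvd_mp_mul_mp ?_) <;> omega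
  have hD_dvd : (X - C θ) ^ (2 * k + 1) ∣ D := by
    refine dvd_sub (pow_dvd_mp_mul_mp ?_) (pow_dvd_mp_mul_mp ?_) <;> omega
  have hB'_dvd : (X - C θ) ^ (2 * k + 2) ∣ B' := by
    refine dvd_sub (dvd_add (pow_dvd_mp_mul_mp ?_) (pow_dvd_mp_mul_mp ?_))
      (pow_dvd_mp_mul_mp ?_) <;> omega
  obtain ⟨hne, hm⟩ := rootMultiplicity_sub_of_lt (θ := θ)
    (mul_ne_zero (mp_ne_zero (G := G) ((S.erase u).erase w)) (mp_ne_zero (S.erase v)))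
    (q := B') (by
      rw [rootMultiplicity_mp_mul_mp]
      exact (pow_dvd_pow _ (by omega)).trans hB'_dvd)
  rw [rootMultiplicity_mp_mul_mp] at hm
  have hdisc : ∀ t, (mp G ((S.erase u).erase w) * mp G (S.erase v) - B').eval t ^ 2 ≤
      (C 4 * (A * D)).eval t := by
    intro t
    have hquad : ∀ s : ℝ, 0 ≤ D.eval t * (s * s) +
        (mp G ((S.erase u).erase w) * mp G (S.erase v) - B').eval t * s + A.eval t := by
      intro s
      have h0 := rayleigh_nonneg (G := G) (Function.update (fun _ => t) w (t + s)) hu hv huv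
      have hup : ∀ T : Finset V, w ∈ T →
          weightedMP G (Function.update (fun _ => t) w (t + s)) T =
            (mp G T).eval t + s * (mp G (T.erase w)).eval t := by
        intro T hT
        rw [eval_mp, eval_mp]
        exact weightedMP_update (fun _ => t) hT s
      rw [rayleigh, hup _ hw, hup _ (Finset.mem_erase.2 ⟨huw.symm, hw⟩),
        hup _ (Finset.mem_erase.2 ⟨hvw.symm, hw⟩),
        hup _ (Finset.mem_erase.2 ⟨hvw.symm, Finset.mem_erase.2 ⟨huw.symm, hw⟩⟩)] at h0
      refine h0.trans_eq ?_
      simp only [hA, hD, hB', eval_sub, eval_add, eval_mul]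
      ring
    have := discrim_le_zero hquad
    rw [discrim] at this
    simp only [eval_mul, eval_C] at this ⊢
    linarith
  have hdvd : (X - C θ) ^ (4 * k + 3) ∣ C 4 * (A * D) := by
    refine Dvd.dvd.mul_left ?_ _
    rw [(by ring : 4 * k + 3 = (2 * k + 2) + (2 * k + 1)), pow_add]
    exact mul_dvd_mul hA_dvd hD_dvd
  have := le_two_mul_rootMultiplicity hne hdisc hdvd
  omega

/-- Gallai's lemma for matching roots: a multiple root `θ` of a connected graph gains multiplicity
when a suitable vertex is deleted. Otherwise every vertex deletion would lower the multiplicity,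
and by transitivity along walks no vertex could lower it after the deletion of `u`. -/
theorem exists_mmult_erase_eq_add_one [Fintype V] (hG : G.Connected)
    (h : 2 ≤ mmult G θ Finset.univ) :
    ∃ u, mmult G θ (Finset.univ.erase u) = mmult G θ Finset.univ + 1 := by
  by_contra! hno
  obtain ⟨u, -, hu⟩ := exists_essential (G := G) (θ := θ) (S := Finset.univ) (by omega)
  have hall : ∀ v, mmult G θ (Finset.univ.erase v) + 1 = mmult G θ Finset.univ ∧
      (u ≠ v → mmult G θ Finset.univ ≤ mmult G θ ((Finset.univ.erase u).erase v) + 1) := by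
    intro v
    have hr := (SimpleGraph.reachable_iff_reflTransGen u v).1 (hG.preconnected u v)
    induction hr with
    | refl => exact ⟨hu, fun h => absurd rfl h⟩
    | @tail v w _ hvw ih =>
      obtain ⟨hv, hp⟩ := ih
      have hw1 := mmult_erase_ne_of_adj (Finset.mem_univ v) (Finset.mem_univ w) hvw hv
      have hw2 := mmult_le_erase (G := G) (θ := θ) (Finset.mem_univ w)
      have hw3 := mmult_erase_le (G := G) (θ := θ) (Finset.mem_univ w)
      have hw4 := hno w
      have hw : mmult G θ (Finset.univ.erase w) + 1 = mmult G θ Finset.univ := by omega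
      refine ⟨hw, fun huw => ?_⟩
      have hedge := mmult_le_erase_edge (θ := θ) (Finset.mem_univ v) (Finset.mem_univ w) hvw
      rcases eq_or_ne u v with rfl | huv
      · exact hedge
      · exact essential_trans (Finset.mem_univ _) (Finset.mem_univ _) (Finset.mem_univ _) huv
          hvw.ne huw hu hv hw (hp huv) hedge
  obtain ⟨v, hv, hv'⟩ := exists_essential (G := G) (θ := θ) (S := Finset.univ.erase u) (by omega)
  have := (hall v).2 (Finset.mem_erase.1 hv).1.symm
  omega

/-- If deleting `u` raises the multiplicity of the root `θ`, then `θ` is not the largest root. -/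
lemma exists_root_gt {S : Finset V} {u : V} (hu : u ∈ S)
    (h : mmult G θ (S.erase u) = mmult G θ S + 1) : ∃ θ' ∈ mroots G S, θ < θ' := by
  by_contra! hno
  -- The quotient `F(S - u) / F(S)` decreases on `(θ, ∞)`, tends to `0` at `θ` and is eventually
  -- positive, which is impossible.
  set p := mp G S with hp
  set q := mp G (S.erase u) with hq
  have hp0 : ∀ t ∈ Set.Ioi θ, p.eval t ≠ 0 := by
    intro t ht h0
    have := hno t (Multiset.mem_toFinset.2 ((mem_roots (mp_ne_zero S)).2 h0))
    exact absurd ht (not_lt.2 this)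
  have hqdeg : 0 < q.natDegree := by
    have := sum_mmult_le (G := G) {θ} (S.erase u)
    rw [Finset.sum_singleton] at this
    rw [hq, natDegree_mp]
    omega
  have hpdeg : 0 < p.natDegree := by
    rw [hp, natDegree_mp]
    exact Finset.card_pos.2 ⟨u, hu⟩
  have hpinf := p.tendsto_atTop_of_leadingCoeff_nonneg (natDegree_pos_iff_degree_pos.1 hpdeg)
    (by rw [(mp_monic S).leadingCoeff]; exact zero_le_one)
  have hqinf := q.tendsto_atTop_of_leadingCoeff_nonneg (natDegree_pos_iff_degree_pos.1 hqdeg)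
    (by rw [(mp_monic _).leadingCoeff]; exact zero_le_one)
  obtain ⟨T, ⟨hpT, hqT⟩, hT⟩ := ((hpinf.eventually_gt_atTop 0).and
    (hqinf.eventually_gt_atTop 0)).and (Filter.eventually_gt_atTop θ) |>.exists
  have hderiv : ∀ t ∈ Set.Ioi θ, HasDerivAt (fun t => q.eval t / p.eval t)
      ((q.derivative.eval t * p.eval t - q.eval t * p.derivative.eval t) / p.eval t ^ 2) t :=
    fun t ht => (q.hasDerivAt t).div (p.hasDerivAt t) (hp0 t ht)
  have hanti : AntitoneOn (fun t => q.eval t / p.eval t) (Set.Ioi θ) := by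
    refine antitoneOn_of_deriv_nonpos (convex_Ioi θ)
      (fun t ht => (hderiv t ht).continuousAt.continuousWithinAt) ?_ ?_
    · rw [interior_Ioi]
      exact fun t ht => (hderiv t ht).differentiableAt.differentiableWithinAt
    · rw [interior_Ioi]
      intro t ht
      rw [(hderiv t ht).deriv]
      refine div_nonpos_of_nonpos_of_nonneg ?_ (sq_nonneg _)
      have := sq_le_wronskian (G := G) hu t
      simp only [eval_sub, eval_mul] at this
      nlinarith [sq_nonneg ((mp G (S.erase u)).eval t)]
  obtain ⟨p₁, hp₁, hp₁0⟩ := exists_eq_pow_mul (mp_ne_zero (G := G) S) θ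
  obtain ⟨q₁, hq₁⟩ : (X - C θ) ^ (mmult G θ S + 1) ∣ mp G (S.erase u) := pow_dvd_mp.2 h.ge
  have hlim : Filter.Tendsto (fun t => q.eval t / p.eval t) (nhdsWithin θ (Set.Ioi θ))
      (nhds 0) := by
    have h1 : Filter.Tendsto (fun t => (t - θ) * q₁.eval t / p₁.eval t)
        (nhdsWithin θ (Set.Ioi θ)) (nhds 0) := by
      have : ContinuousAt (fun t => (t - θ) * q₁.eval t / p₁.eval t) θ :=
        ((continuousAt_id.sub continuousAt_const).mul q₁.continuous.continuousAt).div
          p₁.continuous.continuousAt hp₁0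
      have h2 := this.tendsto
      simp only [sub_self, zero_mul, zero_div] at h2
      exact h2.mono_left nhdsWithin_le_nhds
    refine h1.congr' ?_
    filter_upwards [self_mem_nhdsWithin] with t ht
    have ht' : t - θ ≠ 0 := sub_ne_zero.2 (ne_of_gt ht)
    have hpe : p.eval t = (t - θ) ^ mmult G θ S * p₁.eval t := by
      rw [hp]
      conv_lhs => rw [hp₁]
      simp [mmult]
    have hqe : q.eval t = (t - θ) ^ mmult G θ S * ((t - θ) * q₁.eval t) := by
      rw [hq, hq₁]
      simp
      ring
    rw [hpe, hqe, mul_div_mul_left _ _ (pow_ne_zero _ ht')]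
  have hle : q.eval T / p.eval T ≤ 0 := by
    refine ge_of_tendsto hlim ?_
    filter_upwards [Ioo_mem_nhdsGT hT] with t ht
    exact hanti ht.1 hT ht.2.le
  exact absurd (div_pos hqT hpT) (not_lt.2 hle)

/-- The largest matching root of a connected graph is simple. -/
theorem mmult_largest_le_one [Fintype V] (hG : G.Connected)
    (h : ∀ θ' ∈ mroots G Finset.univ, θ' ≤ θ) : mmult G θ Finset.univ ≤ 1 := by
  by_contra! hlt
  obtain ⟨u, hu⟩ := exists_mmult_erase_eq_add_one hG hlt
  obtain ⟨θ', h1, h2⟩ := exists_root_gt (Finset.mem_univ u) hu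
  exact absurd h2 (not_lt.2 (h θ' h1))

end Gallai

/-! ### Counting roots with multiplicity -/

section Counting

open scoped Classical Polynomial

open Polynomial

variable {V : Type*} {G : SimpleGraph V}

lemma card_eq_sum_mmult (S : Finset V) :
    S.card = 2 * ∑ θ ∈ mroots G S with 0 < θ, mmult G θ S + mmult G 0 S := by
  rw [← sum_mmult (G := G) S, sum_mroots_even S (fun θ => mmult G θ S) (fun θ => mmult_neg θ S)]
  split_ifs with h
  · rfl
  · rw [mem_mroots] at h
    omega

lemma card_mroots_eq (S : Finset V) :
    (mroots G S).card = 2 * ((mroots G S).filter fun θ => 0 < θ).card +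
      if (0 : ℝ) ∈ mroots G S then 1 else 0 := by
  have := sum_mroots_even (G := G) S (fun _ => 1) (fun _ => rfl)
  simpa using this

lemma card_pos_mroots_le (S : Finset V) :
    ((mroots G S).filter fun θ => 0 < θ).card ≤ ∑ θ ∈ mroots G S with 0 < θ, mmult G θ S := by
  rw [Finset.card_eq_sum_ones]
  exact Finset.sum_le_sum fun θ hθ => mem_mroots.1 (Finset.mem_filter.1 hθ).1

lemma card_mroots_le_card (S : Finset V) : (mroots G S).card ≤ S.card := by
  rw [← sum_mmult (G := G) S, Finset.card_eq_sum_ones]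
  exact Finset.sum_le_sum fun θ hθ => mem_mroots.1 hθ

lemma card_mroots_le_three {S : Finset V} (h : S.card ≤ mmult G 0 S + 2) :
    (mroots G S).card ≤ 3 := by
  have h1 := card_eq_sum_mmult (G := G) S
  have h2 := card_pos_mroots_le (G := G) S
  have h3 := card_mroots_eq (G := G) S
  split_ifs at h3 <;> omega

lemma mmult_of_edgeless {S : Finset V} (h : ∀ a ∈ S, ∀ b ∈ S, ¬ G.Adj a b) :
    mmult G 0 S = S.card ∧ ∀ θ ≠ 0, mmult G θ S = 0 := by
  rw [mmult, mp_of_edgeless h]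
  constructor
  · have := rootMultiplicity_X_sub_C_pow (0 : ℝ) S.card
    simpa using this
  · intro θ hθ
    rw [mmult, mp_of_edgeless h]
    exact rootMultiplicity_eq_zero (by simp [IsRoot, hθ])

lemma mmult_zero_add_two_le {S : Finset V} {a b : V} (ha : a ∈ S) (hb : b ∈ S)
    (hab : G.Adj a b) : mmult G 0 S + 2 ≤ S.card := by
  have h0 := length_le_card_mroots (G := G) (S := S) [a, b] (by simpa using hab)
    (by simpa using hab.ne) (by simp [ha, hb])
  have h1 := card_eq_sum_mmult (G := G) S
  have h2 := card_pos_mroots_le (G := G) S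
  have h3 := card_mroots_eq (G := G) S
  simp only [List.length_cons, List.length_nil] at h0
  split_ifs at h3 <;> omega

/-- A positive root of multiplicity `m` occurs, with its negative, `2 m` times. -/
lemma two_mul_mmult_le {S : Finset V} {β : ℝ} (hβ : 0 < β) :
    2 * mmult G β S + mmult G 0 S ≤ S.card := by
  have h1 := card_eq_sum_mmult (G := G) S
  by_cases hm : β ∈ (mroots G S).filter fun θ => 0 < θ
  · have := Finset.single_le_sum (f := fun θ => mmult G θ S) (fun _ _ => Nat.zero_le _) hm
    omega
  · have : mmult G β S = 0 := by
      by_contra h0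
      exact hm (Finset.mem_filter.2 ⟨mem_mroots.2 (Nat.pos_of_ne_zero h0), hβ⟩)
    omega

variable [Fintype V]

/-- If there are exactly two positive roots, the larger one is simple, and the number of vertices is
determined by the multiplicities of the smaller one, `β`, and of `0`. -/
lemma exists_two_pos_roots (hG : G.Connected)
    (h : ((mroots G Finset.univ).filter fun θ => 0 < θ).card = 2) :
    ∃ β : ℝ, 0 < β ∧ 1 ≤ mmult G β Finset.univ ∧
      Fintype.card V = 2 * (mmult G β Finset.univ + 1) + mmult G 0 Finset.univ := by
  obtain ⟨a, b, hab, hR⟩ := Finset.card_eq_two.1 h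
  obtain ⟨α, β, hlt, hR⟩ : ∃ α β : ℝ, β < α ∧
      (mroots G Finset.univ).filter (fun θ => 0 < θ) = {α, β} := by
    rcases lt_or_gt_of_ne hab with h' | h'
    · exact ⟨b, a, h', by rw [hR, Finset.pair_comm]⟩
    · exact ⟨a, b, h', hR⟩
  have hα : α ∈ mroots G Finset.univ ∧ 0 < α := Finset.mem_filter.1 (by rw [hR]; simp)
  have hβ : β ∈ mroots G Finset.univ ∧ 0 < β := Finset.mem_filter.1 (by rw [hR]; simp)
  have h1 : mmult G α Finset.univ = 1 := by
    refine le_antisymm (mmult_largest_le_one hG fun θ' hθ' => ?_) (mem_mroots.1 hα.1)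
    rcases le_or_gt θ' 0 with h0 | h0
    · exact h0.trans hα.2.le
    · have : θ' ∈ (mroots G Finset.univ).filter (fun θ => 0 < θ) :=
        Finset.mem_filter.2 ⟨hθ', h0⟩
      rw [hR, Finset.mem_insert, Finset.mem_singleton] at this
      rcases this with rfl | rfl
      · exact le_rfl
      · exact hlt.le
  have h2 := card_eq_sum_mmult (G := G) Finset.univ
  rw [hR, Finset.sum_pair hlt.ne', h1, Finset.card_univ] at h2
  exact ⟨β, hβ.2, mem_mroots.1 hβ.1, by omega⟩

lemma card_eq_four (hG : G.Connected) (h : (mroots G Finset.univ).card = 4) :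
    Fintype.card V = 4 := by
  have h1 := card_mroots_eq (G := G) Finset.univ
  have h0 : (0 : ℝ) ∉ mroots G Finset.univ := by
    intro h0
    rw [if_pos h0] at h1
    omega
  rw [if_neg h0] at h1
  rw [mem_mroots] at h0
  obtain ⟨β, hβ, hm, hcard⟩ := exists_two_pos_roots hG (by omega)
  by_contra hne
  obtain ⟨u, hu⟩ := exists_mmult_erase_eq_add_one hG (θ := β) (by omega)
  have h2 := two_mul_mmult_le (G := G) (S := Finset.univ.erase u) hβ
  have h3 := Finset.card_erase_add_one (Finset.mem_univ u)
  rw [Finset.card_univ] at h3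
  omega

/-- If `G` has five distinct matching roots and more than five vertices, then `0` or a positive
root `β` is a multiple root, and a vertex that raises its multiplicity leaves a graph with at most
three distinct matching roots. -/
lemma exists_vertex_of_five_roots (hG : G.Connected) (h : (mroots G Finset.univ).card = 5) :
    Fintype.card V = 5 ∨
    (∃ u, mmult G 0 (Finset.univ.erase u) + 2 = (Finset.univ.erase u).card) ∨
    ∃ u β, 0 < β ∧ 3 ≤ mmult G β (Finset.univ.erase u) ∧
      (∀ θ ∈ mroots G (Finset.univ.erase u), 0 < θ → θ = β) ∧
      mmult G 0 (Finset.univ.erase u) + 1 = mmult G 0 Finset.univ := by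
  have h1 := card_mroots_eq (G := G) Finset.univ
  have h0 : (0 : ℝ) ∈ mroots G Finset.univ := by
    by_contra h0
    rw [if_neg h0] at h1
    omega
  rw [if_pos h0] at h1
  rw [mem_mroots] at h0
  obtain ⟨β, hβ, hm, hcard⟩ := exists_two_pos_roots hG (by omega)
  rcases hm.eq_or_lt with hm1 | hm2
  · by_cases hm0 : mmult G 0 Finset.univ = 1
    · left; omega
    · obtain ⟨u, hu⟩ := exists_mmult_erase_eq_add_one hG (θ := 0) (by omega)
      have h3 := Finset.card_erase_add_one (Finset.mem_univ u)
      rw [Finset.card_univ] at h3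
      exact Or.inr (Or.inl ⟨u, by omega⟩)
  · obtain ⟨u, hu⟩ := exists_mmult_erase_eq_add_one hG hm2
    have h2 := two_mul_mmult_le (G := G) (S := Finset.univ.erase u) hβ
    have h3 := Finset.card_erase_add_one (Finset.mem_univ u)
    rw [Finset.card_univ] at h3
    have h4 := mmult_le_erase (G := G) (θ := 0) (Finset.mem_univ u)
    refine Or.inr (Or.inr ⟨u, β, hβ, by omega, fun θ hθ hpos => ?_, by omega⟩)
    by_contra hne
    have h5 := card_eq_sum_mmult (G := G) (Finset.univ.erase u)
    have h6 : ∑ θ' ∈ {θ, β}, mmult G θ' (Finset.univ.erase u) ≤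
        ∑ θ ∈ mroots G (Finset.univ.erase u) with 0 < θ, mmult G θ (Finset.univ.erase u) := by
      refine Finset.sum_le_sum_of_subset fun x hx => ?_
      rcases Finset.mem_insert.1 hx with rfl | hx
      · exact Finset.mem_filter.2 ⟨hθ, hpos⟩
      · rw [Finset.mem_singleton.1 hx]
        exact Finset.mem_filter.2 ⟨mem_mroots.2 (by omega), hβ⟩
    rw [Finset.sum_pair hne] at h6
    have h7 := mem_mroots.1 hθ
    omega

lemma card_mroots_of_isStar (h : IsStar G) : (mroots G Finset.univ).card ≤ 3 := by
  obtain ⟨s, -, ⟨e⟩⟩ := h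
  have hno : ∀ a ∈ Finset.univ.erase (e.symm (Sum.inl 0)),
      ∀ b ∈ Finset.univ.erase (e.symm (Sum.inl 0)), ¬ G.Adj a b := by
    intro a ha b hb hab
    have h1 := (e.map_adj_iff).2 hab
    have ha' : e a ≠ Sum.inl 0 := fun h => (Finset.mem_erase.1 ha).1 (by rw [← h]; simp)
    have hb' : e b ≠ Sum.inl 0 := fun h => (Finset.mem_erase.1 hb).1 (by rw [← h]; simp)
    rcases hea : e a with i | i
    · exact ha' (by rw [hea, Subsingleton.elim i 0])
    rcases heb : e b with j | j
    · exact hb' (by rw [heb, Subsingleton.elim j 0])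
    rw [hea, heb] at h1
    simp [star] at h1
  have h1 := (mmult_of_edgeless hno).1
  have h2 := mmult_erase_le (G := G) (θ := 0) (Finset.mem_univ (e.symm (Sum.inl 0)))
  have h3 := Finset.card_erase_add_one (Finset.mem_univ (e.symm (Sum.inl 0)))
  exact card_mroots_le_three (by omega)

end Counting

/-! ### Graphs without a path on four vertices -/

section Structure

variable {V : Type*}

/-- `H` contains no path on four vertices. -/
def NoP4 (H : SimpleGraph V) : Prop :=
  ∀ a b c d, H.Adj a b → H.Adj b c → H.Adj c d → a ≠ c → a ≠ d → b ≠ d → False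

/-- `c` is the centre of a connected component of `H` that is a star `K_{1,k}`, `k ≥ 1`. -/
def IsStarCentre (H : SimpleGraph V) (c : V) : Prop :=
  (∃ x, H.Adj c x) ∧ ∀ x, H.Adj c x → ∀ y, H.Adj x y → y = c

lemma NoP4.triangle_closed {H : SimpleGraph V} (hH : NoP4 H) {a b c d : V} (hab : H.Adj a b)
    (hbc : H.Adj b c) (hac : H.Adj a c) (had : H.Adj a d) : d = b ∨ d = c := by
  by_contra! h
  exact hH d a b c had.symm hab hbc h.1 h.2 hac.ne

lemma NoP4.isStarCentre_of_leaf {H : SimpleGraph V} (hH : NoP4 H) {v w : V} (hvw : H.Adj v w)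
    (hv : ∀ x, H.Adj v x → x = w) : IsStarCentre H w := by
  refine ⟨⟨v, hvw.symm⟩, fun x hwx y hxy => ?_⟩
  by_contra hyw
  rcases eq_or_ne x v with rfl | hxv
  · exact hyw (hv y hxy)
  refine hH v w x y hvw hwx hxy hxv.symm ?_ (Ne.symm hyw)
  rintro rfl
  exact hwx.ne' (hv x hxy.symm)

/-- Without a path on four vertices every nontrivial component is a star or a triangle. -/
lemma NoP4.edge_cases {H : SimpleGraph V} (hH : NoP4 H) {v w : V} (hvw : H.Adj v w) :
    IsStarCentre H v ∨ IsStarCentre H w ∨ ∃ x, H.Adj v x ∧ H.Adj w x := by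
  by_cases hv : ∀ x, H.Adj v x → x = w
  · exact Or.inr (Or.inl (hH.isStarCentre_of_leaf hvw hv))
  by_cases hw : ∀ x, H.Adj w x → x = v
  · exact Or.inl (hH.isStarCentre_of_leaf hvw.symm hw)
  push Not at hv hw
  obtain ⟨x, hx, hxw⟩ := hv
  obtain ⟨y, hy, hyv⟩ := hw
  rcases eq_or_ne x y with rfl | hxy
  · exact Or.inr (Or.inr ⟨x, hx, hy⟩)
  · exact (hH x v w y hx.symm hvw hy hxw hxy hyv.symm).elim

lemma eq_univ_of_closed {G : SimpleGraph V} (hG : G.Connected) {C : Set V} (hne : C.Nonempty)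
    (hC : ∀ a ∈ C, ∀ b, G.Adj a b → b ∈ C) (v : V) : v ∈ C := by
  obtain ⟨a, ha⟩ := hne
  have hr := (SimpleGraph.reachable_iff_reflTransGen a v).1 (hG.preconnected a v)
  induction hr with
  | refl => exact ha
  | tail _ h ih => exact hC _ ih _ h

/-- A nonempty union of components of `G - u` contains a neighbour of `u`. -/
lemma exists_adj_of_closed {G : SimpleGraph V} (hG : G.Connected) {u : V} {C : Set V}
    (hne : C.Nonempty) (hu : u ∉ C)
    (hC : ∀ a ∈ C, ∀ b, (G.deleteIncidenceSet u).Adj a b → b ∈ C) : ∃ p ∈ C, G.Adj u p := by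
  by_contra! hno
  refine hu (eq_univ_of_closed hG hne (fun a ha b hab => ?_) u)
  refine hC a ha b (SimpleGraph.deleteIncidenceSet_adj.2 ⟨hab, ?_, ?_⟩)
  · rintro rfl; exact hu ha
  · rintro rfl; exact hno a ha hab.symm

lemma adj_of_isolated {G : SimpleGraph V} {u : V} (hG : G.Connected) {v : V}
    (hvu : v ≠ u) (hv : ∀ y, ¬ (G.deleteIncidenceSet u).Adj v y) : G.Adj u v := by
  obtain ⟨p, rfl, hp⟩ := exists_adj_of_closed (C := {v}) hG (Set.singleton_nonempty v)
    (by simpa using hvu.symm) (by rintro a rfl b hab; exact absurd hab (hv b))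
  exact hp

section Finite

open scoped Classical

variable {G : SimpleGraph V}

lemma noP4_of_card_mroots_le [Fintype V] (h : (mroots G Finset.univ).card ≤ 3) : NoP4 G := by
  intro a b c d hab hbc hcd hac had hbd
  have := length_le_card_mroots (G := G) (S := Finset.univ) [a, b, c, d]
    (by simp [hab, hbc, hcd]) (by simp [hab.ne, hbc.ne, hcd.ne, hac, had, hbd]) (by simp)
  simp only [List.length_cons, List.length_nil] at this
  omega

lemma noP4_deleteIncidenceSet [Fintype V] {u : V}
    (h : (mroots G (Finset.univ.erase u)).card ≤ 3) : NoP4 (G.deleteIncidenceSet u) := by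
  intro a b c d hab hbc hcd hac had hbd
  rw [SimpleGraph.deleteIncidenceSet_adj] at hab hbc hcd
  have := length_le_card_mroots (G := G) (S := Finset.univ.erase u) [a, b, c, d]
    (by simp [hab.1, hbc.1, hcd.1])
    (by simp [hab.1.ne, hbc.1.ne, hcd.1.ne, hac, had, hbd])
    (by simp [hab.2.1, hbc.2.1, hcd.2.1, hcd.2.2])
  simp only [List.length_cons, List.length_nil] at this
  omega

end Finite

end Structure

/-! ### Isomorphisms, and graphs with two or three matching roots -/

section Isomorphisms

open scoped Classical

variable {V : Type*} {G : SimpleGraph V}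

lemma nonempty_iso_of_bijective {W : Type*} {H : SimpleGraph W} (f : W → V)
    (hf : Function.Bijective f) (h : ∀ a b, G.Adj (f a) (f b) ↔ H.Adj a b) :
    Nonempty (G ≃g H) :=
  ⟨RelIso.symm ⟨Equiv.ofBijective f hf, fun {a b} => h a b⟩⟩

/-- To identify `G` with `addVertex H A`, parametrize the vertices other than `u` by `H`. -/
lemma nonempty_iso_addVertex {W : Type*} {H : SimpleGraph W} {A : Set W} (u : V) (g : W → V)
    (hinj : Function.Injective g) (hne : ∀ a, g a ≠ u) (hsurj : ∀ v, v ≠ u → ∃ a, g a = v)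
    (hadj : ∀ a b, G.Adj (g a) (g b) ↔ H.Adj a b) (hA : ∀ a, G.Adj u (g a) ↔ a ∈ A) :
    Nonempty (G ≃g addVertex H A) := by
  refine nonempty_iso_of_bijective (fun o => o.elim u g) ⟨?_, ?_⟩ ?_
  · rintro (_ | a) (_ | b) hab
    · rfl
    · exact absurd hab.symm (hne b)
    · exact absurd hab (hne a)
    · exact congrArg some (hinj hab)
  · intro v
    by_cases hv : v = u
    · exact ⟨none, hv.symm⟩
    · obtain ⟨a, ha⟩ := hsurj v hv
      exact ⟨some a, ha⟩
  · rintro (_ | a) (_ | b)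
    · simp [addVertex]
    · exact hA b
    · exact (G.adj_comm _ _).trans (hA a)
    · exact hadj a b

/-- An enumeration of a finite type that lists the elements with the property `P` first. -/
lemma exists_fin_equiv_lt {α : Type*} [Finite α] (P : α → Prop) :
    ∃ (n l : ℕ) (e : Fin n ≃ α), l ≤ n ∧ ∀ i, P (e i) ↔ (i : ℕ) < l := by
  obtain ⟨l, ⟨e₁⟩⟩ := Finite.exists_equiv_fin {x // P x}
  obtain ⟨m, ⟨e₂⟩⟩ := Finite.exists_equiv_fin {x // ¬ P x}
  refine ⟨l + m, l, finSumFinEquiv.symm.trans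
    ((Equiv.sumCongr e₁.symm e₂.symm).trans (Equiv.sumCompl P)), Nat.le_add_right _ _, fun i => ?_⟩
  obtain ⟨j, rfl⟩ := finSumFinEquiv.surjective i
  rcases j with j | j
  · simpa using (e₁.symm j).2
  · simpa using (e₂.symm j).2

lemma isStar_of_isStarCentre [Finite V] (hG : G.Connected) {c : V} (hc : IsStarCentre G c) :
    IsStar G := by
  obtain ⟨k, ⟨e⟩⟩ := Finite.exists_equiv_fin {x // G.Adj c x}
  have hall : ∀ v, v = c ∨ G.Adj c v := by
    refine eq_univ_of_closed (C := {v | v = c ∨ G.Adj c v}) hG ⟨c, Or.inl rfl⟩ ?_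
    rintro a (rfl | ha) b hab
    · exact Or.inr hab
    · exact Or.inl (hc.2 a ha b hab)
  refine ⟨k, ?_, nonempty_iso_of_bijective
    (Sum.elim (fun _ => c) fun i => (e.symm i : V)) ⟨?_, ?_⟩ ?_⟩
  · obtain ⟨x, hx⟩ := hc.1
    exact Fin.pos (e ⟨x, hx⟩)
  · rintro (i | i) (j | j) h
    · exact congrArg Sum.inl (Subsingleton.elim i j)
    · exact absurd (h : c = _) (e.symm j).2.ne
    · exact absurd (h : _ = c) (e.symm i).2.ne'
    · exact congrArg Sum.inr (e.symm.injective (Subtype.ext h))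
  · intro v
    rcases hall v with rfl | hv
    · exact ⟨Sum.inl 0, rfl⟩
    · exact ⟨Sum.inr (e ⟨v, hv⟩), by simp⟩
  · rintro (i | i) (j | j)
    · simp [star]
    · simpa [star] using (e.symm j).2
    · simpa [star] using (e.symm i).2.symm
    · simp only [star, Sum.elim_inr, completeBipartiteGraph_adj, Sum.isLeft_inr,
        Bool.false_eq_true, false_and, and_false, or_false, iff_false]
      intro h
      exact (e.symm j).2.ne' (hc.2 _ (e.symm i).2 _ h)

lemma nonempty_iso_top_of_forall_adj [Fintype V] {n : ℕ} (hn : Fintype.card V = n)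
    (h : ∀ a b, a ≠ b → G.Adj a b) : Nonempty (G ≃g (⊤ : SimpleGraph (Fin n))) := by
  have e := (Fintype.equivFinOfCardEq hn).symm
  refine nonempty_iso_of_bijective e e.bijective fun a b => ?_
  rw [SimpleGraph.top_adj]
  exact ⟨fun hab he => hab.ne (congrArg e he), fun hab => h _ _ (e.injective.ne hab)⟩

lemma nonempty_iso_top_three [Fintype V] (hG : G.Connected) (hP : NoP4 G) {a b c : V}
    (hab : G.Adj a b) (hbc : G.Adj b c) (hac : G.Adj a c) :
    Nonempty (G ≃g (⊤ : SimpleGraph (Fin 3))) := by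
  have hall : ∀ v, v = a ∨ v = b ∨ v = c := by
    refine eq_univ_of_closed (C := {v | v = a ∨ v = b ∨ v = c}) hG ⟨a, Or.inl rfl⟩ ?_
    rintro x (rfl | rfl | rfl) y hxy
    · exact Or.inr (hP.triangle_closed hab hbc hac hxy)
    · rcases hP.triangle_closed hab.symm hac hbc hxy with h | h
      · exact Or.inl h
      · exact Or.inr (Or.inr h)
    · rcases hP.triangle_closed hac.symm hab hbc.symm hxy with h | h
      · exact Or.inl h
      · exact Or.inr (Or.inl h)
  have hcard : Fintype.card V = 3 := by
    rw [← Finset.card_univ, Finset.card_eq_three]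
    refine ⟨a, b, c, hab.ne, hac.ne, hbc.ne, ?_⟩
    ext v
    simpa using hall v
  refine nonempty_iso_top_of_forall_adj hcard fun x y hxy => ?_
  rcases hall x with rfl | rfl | rfl <;> rcases hall y with rfl | rfl | rfl <;>
    first
      | exact absurd rfl hxy
      | assumption
      | (apply SimpleGraph.Adj.symm; assumption)

lemma exists_adj_of_connected [Fintype V] (hG : G.Connected) (h : 2 ≤ Fintype.card V) :
    ∃ a b, G.Adj a b := by
  obtain ⟨a⟩ := hG.nonempty
  by_contra! hno
  have : ∀ v, v = a := eq_univ_of_closed (C := {v | v = a}) hG ⟨a, rfl⟩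
    fun x _ y hxy => absurd hxy (hno x y)
  have : Fintype.card V ≤ 1 :=
    Fintype.card_le_one_iff.2 fun x y => (this x).trans (this y).symm
  omega

lemma nonempty_iso_top_two [Fintype V] (hG : G.Connected)
    (h : (mroots G Finset.univ).card = 2) : Nonempty (G ≃g (⊤ : SimpleGraph (Fin 2))) := by
  have h1 := card_mroots_le_card (G := G) Finset.univ
  rw [Finset.card_univ] at h1
  obtain ⟨a, b, hab⟩ := exists_adj_of_connected hG (by omega)
  have hno : ∀ x y z, G.Adj x y → G.Adj y z → x = z := by
    intro x y z hxy hyz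
    by_contra hxz
    have := length_le_card_mroots (G := G) (S := Finset.univ) [x, y, z]
      (by simp [hxy, hyz]) (by simp [hxy.ne, hyz.ne, hxz]) (by simp)
    simp only [List.length_cons, List.length_nil] at this
    omega
  have hall : ∀ v, v = a ∨ v = b := by
    refine eq_univ_of_closed (C := {v | v = a ∨ v = b}) hG ⟨a, Or.inl rfl⟩ ?_
    rintro x (rfl | rfl) y hxy
    · exact Or.inr (hno _ _ _ hab.symm hxy).symm
    · exact Or.inl (hno _ _ _ hab hxy).symm
  have hcard : Fintype.card V = 2 := by
    rw [← Finset.card_univ, Finset.card_eq_two]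
    refine ⟨a, b, hab.ne, ?_⟩
    ext v
    simpa using hall v
  refine nonempty_iso_top_of_forall_adj hcard fun x y hxy => ?_
  rcases hall x with rfl | rfl <;> rcases hall y with rfl | rfl
  · exact absurd rfl hxy
  · exact hab
  · exact hab.symm
  · exact absurd rfl hxy

lemma isStar_or_nonempty_iso_top_three [Fintype V] (hG : G.Connected)
    (h : (mroots G Finset.univ).card = 3) :
    IsStar G ∨ Nonempty (G ≃g (⊤ : SimpleGraph (Fin 3))) := by
  have h1 := card_mroots_le_card (G := G) Finset.univ
  rw [Finset.card_univ] at h1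
  obtain ⟨a, b, hab⟩ := exists_adj_of_connected hG (by omega)
  have hP := noP4_of_card_mroots_le (G := G) h.le
  rcases hP.edge_cases hab with hc | hc | ⟨x, hax, hbx⟩
  · exact Or.inl (isStar_of_isStarCentre hG hc)
  · exact Or.inl (isStar_of_isStarCentre hG hc)
  · exact Or.inr (nonempty_iso_top_three hG hP hab hbx hax)

end Isomorphisms

/-! ### A vertex whose deletion leaves one nontrivial component -/

section OneNontrivialComponent

open scoped Classical

variable {V : Type*} [Fintype V] {G : SimpleGraph V} {u : V}

lemma mp_erase_eq_mul {C : Finset V} (hCu : u ∉ C)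
    (hC : ∀ a ∈ C, ∀ b, (G.deleteIncidenceSet u).Adj a b → b ∈ C) :
    mp G (Finset.univ.erase u) = mp G C * mp G (Finset.univ.erase u \ C) := by
  have hsub : C ⊆ Finset.univ.erase u := fun a ha =>
    Finset.mem_erase.2 ⟨fun h => hCu (h ▸ ha), Finset.mem_univ a⟩
  rw [← mp_union _ _ Finset.disjoint_sdiff, Finset.union_sdiff_of_subset hsub]
  intro a ha b hb hab
  rw [Finset.mem_sdiff, Finset.mem_erase] at hb
  refine hb.2 (hC a ha b (SimpleGraph.deleteIncidenceSet_adj.2 ⟨hab, ?_, hb.1.1⟩))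
  rintro rfl
  exact hCu ha

/-- If `0` has the largest possible multiplicity in `G - u`, then `G - u` has only one component
with an edge. -/
lemma mem_of_adj_of_mmult_zero {C : Finset V} (hCu : u ∉ C)
    (hm : mmult G 0 (Finset.univ.erase u) + 2 = (Finset.univ.erase u).card)
    (hC : ∀ a ∈ C, ∀ b, (G.deleteIncidenceSet u).Adj a b → b ∈ C) {a b : V} (ha : a ∈ C)
    (hab : (G.deleteIncidenceSet u).Adj a b) {x y : V}
    (hxy : (G.deleteIncidenceSet u).Adj x y) : x ∈ C := by
  by_contra hx
  have hy : y ∉ C := fun hy => hx (hC y hy x hxy.symm)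
  have hsub : C ⊆ Finset.univ.erase u := fun a ha =>
    Finset.mem_erase.2 ⟨fun h => hCu (h ▸ ha), Finset.mem_univ a⟩
  have h1 := mmult_zero_add_two_le ha (hC a ha b hab)
    (SimpleGraph.deleteIncidenceSet_adj.1 hab).1
  obtain ⟨hxy', hxu, hyu⟩ := SimpleGraph.deleteIncidenceSet_adj.1 hxy
  have h2 := mmult_zero_add_two_le (G := G) (S := Finset.univ.erase u \ C) (a := x) (b := y)
    (by simp [hx, hxu]) (by simp [hy, hyu]) hxy'
  have h3 := rootMultiplicity_mp_mul_mp (G := G) (θ := 0) C (Finset.univ.erase u \ C)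
  rw [← mp_erase_eq_mul hCu hC] at h3
  change mmult G 0 (Finset.univ.erase u) = _ at h3
  have h4 := Finset.card_sdiff_add_card_eq_card hsub
  omega

lemma nonempty_iso_graphK_or_graphK' (hG : G.Connected)
    (hm : mmult G 0 (Finset.univ.erase u) + 2 = (Finset.univ.erase u).card) {c : V}
    (hc : IsStarCentre (G.deleteIncidenceSet u) c) :
    (∃ k t l : ℕ, 1 ≤ l ∧ l ≤ k ∧ Nonempty (G ≃g graphK k t l)) ∨
      (∃ k t l : ℕ, 1 ≤ k ∧ l ≤ k ∧ Nonempty (G ≃g graphK' k t l)) := by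
  set H := G.deleteIncidenceSet u with hH
  obtain ⟨x₀, hx₀⟩ := hc.1
  have hcu : c ≠ u := (SimpleGraph.deleteIncidenceSet_adj.1 hx₀).2.1
  have hlu : ∀ x, H.Adj c x → x ≠ u := fun x hx =>
    (SimpleGraph.deleteIncidenceSet_adj.1 hx).2.2
  have hGH : ∀ a b, a ≠ u → b ≠ u → (G.Adj a b ↔ H.Adj a b) := fun a b ha hb => by
    rw [hH, SimpleGraph.deleteIncidenceSet_adj]
    tauto
  have hclosed : ∀ a, (a = c ∨ H.Adj c a) → ∀ b, H.Adj a b → (b = c ∨ H.Adj c b) := by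
    rintro a (rfl | ha) b hab
    · exact Or.inr hab
    · exact Or.inl (hc.2 a ha b hab)
  have hiso : ∀ v, v ≠ c → ¬ H.Adj c v → ∀ y, ¬ H.Adj v y := by
    intro v hvc hcv y hvy
    have := mem_of_adj_of_mmult_zero (C := Finset.univ.filter fun a => a = c ∨ H.Adj c a)
      (by simpa [hcu.symm] using fun h => hlu u h rfl) hm (by simpa using hclosed)
      (by simp) hx₀ hvy
    simp [hvc, hcv] at this
  obtain ⟨k, l, e₁, hlk, hl⟩ := exists_fin_equiv_lt (α := {x // H.Adj c x}) fun x => G.Adj u x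
  obtain ⟨t, ⟨e₂⟩⟩ := Finite.exists_equiv_fin {x // x ≠ u ∧ x ≠ c ∧ ¬ H.Adj c x}
  let g : (Fin 1 ⊕ Fin k) ⊕ Fin t → V :=
    Sum.elim (Sum.elim (fun _ => c) fun i => e₁ i) fun j => e₂.symm j
  have hne : ∀ a, g a ≠ u := by
    rintro ((i | i) | j)
    · exact hcu
    · exact hlu _ (e₁ i).2
    · exact (e₂.symm j).2.1
  have hinj : Function.Injective g := by
    rintro ((i | i) | i) ((j | j) | j) h
    · rw [Subsingleton.elim i j]
    · exact absurd h (e₁ j).2.ne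
    · exact absurd h.symm (e₂.symm j).2.2.1
    · exact absurd h (e₁ i).2.ne'
    · rw [e₁.injective (Subtype.ext h)]
    · exact absurd (by rw [← show (e₁ i : V) = e₂.symm j from h]; exact (e₁ i).2)
        (e₂.symm j).2.2.2
    · exact absurd h (e₂.symm i).2.2.1
    · exact absurd (by rw [show (e₂.symm i : V) = e₁ j from h]; exact (e₁ j).2)
        (e₂.symm i).2.2.2
    · rw [e₂.symm.injective (Subtype.ext h)]
  have hsurj : ∀ v, v ≠ u → ∃ a, g a = v := by
    intro v hv
    by_cases hvc : v = c
    · exact ⟨Sum.inl (Sum.inl 0), hvc.symm⟩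
    by_cases hcv : H.Adj c v
    · exact ⟨Sum.inl (Sum.inr (e₁.symm ⟨v, hcv⟩)), by simp [g]⟩
    · exact ⟨Sum.inr (e₂ ⟨v, hv, hvc, hcv⟩), by simp [g]⟩
  have hadj : ∀ a b, G.Adj (g a) (g b) ↔ (star k ⊕g (⊥ : SimpleGraph (Fin t))).Adj a b := by
    intro a b
    rw [hGH _ _ (hne a) (hne b)]
    have hR : ∀ j y, ¬ H.Adj (e₂.symm j : V) y := fun j =>
      hiso _ (e₂.symm j).2.2.1 (e₂.symm j).2.2.2
    rcases a with (i | i) | i <;> rcases b with (j | j) | j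
    · simp [g, star]
    · simpa [g, star] using (e₁ j).2
    · simpa [g, star] using (e₂.symm j).2.2.2
    · simpa [g, star] using (e₁ i).2.symm
    · simp only [g, star, Sum.elim_inl, Sum.elim_inr, SimpleGraph.sum_adj,
        completeBipartiteGraph_adj, Sum.isLeft_inr, Bool.false_eq_true, false_and, and_false,
        or_false, iff_false]
      exact fun h => (e₁ j).2.ne' (hc.2 _ (e₁ i).2 _ h)
    · simpa [g, star] using fun h => hR j _ (SimpleGraph.Adj.symm h)
    · simpa [g, star] using hR i _
    · simpa [g, star] using hR i _
    · simpa [g, star] using hR i _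
  have hleaf : ∀ i : Fin k, G.Adj u (g (Sum.inl (Sum.inr i))) ↔ (i : ℕ) < l := hl
  have hrest : ∀ j : Fin t, G.Adj u (g (Sum.inr j)) := fun j =>
    adj_of_isolated hG (e₂.symm j).2.1 (hiso _ (e₂.symm j).2.2.1 (e₂.symm j).2.2.2)
  by_cases huc : G.Adj u c
  · refine Or.inr ⟨k, t, l, Fin.pos (e₁.symm ⟨x₀, hx₀⟩), hlk,
      nonempty_iso_addVertex u g hinj hne hsurj hadj ?_⟩
    rintro ((i | i) | i)
    · simpa [g, Subsingleton.elim i 0] using huc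
    · simpa using hleaf i
    · simpa using hrest i
  · refine Or.inl ⟨k, t, l, ?_, hlk, nonempty_iso_addVertex u g hinj hne hsurj hadj ?_⟩
    · obtain ⟨p, hp, hup⟩ := exists_adj_of_closed (C := {a | a = c ∨ H.Adj c a}) hG
        ⟨c, Or.inl rfl⟩ (by rintro (h | h); exacts [hcu h.symm, hlu u h rfl]) hclosed
      rcases hp with rfl | hp
      · exact absurd hup huc
      · have := (hl (e₁.symm ⟨p, hp⟩)).1 (by simpa using hup)
        omega
    · rintro ((i | i) | i)
      · simpa [g] using huc
      · simpa using hleaf i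
      · simpa using hrest i

lemma nonempty_iso_graphL (hG : G.Connected)
    (hm : mmult G 0 (Finset.univ.erase u) + 2 = (Finset.univ.erase u).card)
    (hP : NoP4 (G.deleteIncidenceSet u)) {a b c : V}
    (hab : (G.deleteIncidenceSet u).Adj a b) (hbc : (G.deleteIncidenceSet u).Adj b c)
    (hac : (G.deleteIncidenceSet u).Adj a c) :
    ∃ t l : ℕ, 1 ≤ l ∧ l ≤ 3 ∧ Nonempty (G ≃g graphL t l) := by
  set H := G.deleteIncidenceSet u with hH
  have hau : a ≠ u := (SimpleGraph.deleteIncidenceSet_adj.1 hab).2.1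
  have hbu : b ≠ u := (SimpleGraph.deleteIncidenceSet_adj.1 hab).2.2
  have hcu : c ≠ u := (SimpleGraph.deleteIncidenceSet_adj.1 hac).2.2
  have hGH : ∀ a b, a ≠ u → b ≠ u → (G.Adj a b ↔ H.Adj a b) := fun a b ha hb => by
    rw [hH, SimpleGraph.deleteIncidenceSet_adj]
    tauto
  have hclosed : ∀ x, (x = a ∨ x = b ∨ x = c) → ∀ y, H.Adj x y → (y = a ∨ y = b ∨ y = c) := by
    rintro x (rfl | rfl | rfl) y hxy
    · exact Or.inr (hP.triangle_closed hab hbc hac hxy)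
    · rcases hP.triangle_closed hab.symm hac hbc hxy with h | h
      · exact Or.inl h
      · exact Or.inr (Or.inr h)
    · rcases hP.triangle_closed hac.symm hab hbc.symm hxy with h | h
      · exact Or.inl h
      · exact Or.inr (Or.inl h)
  have htri : ∀ x, (x = a ∨ x = b ∨ x = c) → ∀ y, (y = a ∨ y = b ∨ y = c) → x ≠ y →
      H.Adj x y := by
    rintro x (rfl | rfl | rfl) y (rfl | rfl | rfl) hxy <;>
      first
        | exact absurd rfl hxy
        | assumption
        | (apply SimpleGraph.Adj.symm; assumption)
  have hTu : ∀ x, (x = a ∨ x = b ∨ x = c) → x ≠ u := by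
    rintro x (rfl | rfl | rfl) <;> assumption
  have hiso : ∀ v, ¬ (v = a ∨ v = b ∨ v = c) → ∀ y, ¬ H.Adj v y := by
    intro v hv y hvy
    have := mem_of_adj_of_mmult_zero (C := Finset.univ.filter fun x => x = a ∨ x = b ∨ x = c)
      (by simpa using fun h => hTu u h rfl) hm (by simpa using hclosed)
      (by simp) hab hvy
    simp only [Finset.mem_filter, Finset.mem_univ, true_and] at this
    exact hv this
  obtain ⟨n, l, e₁, hln, hl⟩ :=
    exists_fin_equiv_lt (α := {x // x = a ∨ x = b ∨ x = c}) fun x => G.Adj u x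
  obtain rfl : n = 3 := by
    have h1 := Fintype.card_congr e₁
    rw [Fintype.card_fin] at h1
    rw [h1, Fintype.card_subtype, Finset.card_eq_three]
    refine ⟨a, b, c, hab.ne, hac.ne, hbc.ne, ?_⟩
    ext v
    simp
  obtain ⟨t, ⟨e₂⟩⟩ := Finite.exists_equiv_fin {x // x ≠ u ∧ ¬ (x = a ∨ x = b ∨ x = c)}
  let g : Fin 3 ⊕ Fin t → V := Sum.elim (fun i => e₁ i) fun j => e₂.symm j
  have hne : ∀ a, g a ≠ u := by
    rintro (i | j)
    · exact hTu _ (e₁ i).2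
    · exact (e₂.symm j).2.1
  have hinj : Function.Injective g := by
    rintro (i | i) (j | j) h
    · rw [e₁.injective (Subtype.ext h)]
    · exact absurd (by rw [← show (e₁ i : V) = e₂.symm j from h]; exact (e₁ i).2)
        (e₂.symm j).2.2
    · exact absurd (by rw [show (e₂.symm i : V) = e₁ j from h]; exact (e₁ j).2)
        (e₂.symm i).2.2
    · rw [e₂.symm.injective (Subtype.ext h)]
  have hsurj : ∀ v, v ≠ u → ∃ a, g a = v := by
    intro v hv
    by_cases hT : v = a ∨ v = b ∨ v = c
    · exact ⟨Sum.inl (e₁.symm ⟨v, hT⟩), by simp [g]⟩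
    · exact ⟨Sum.inr (e₂ ⟨v, hv, hT⟩), by simp [g]⟩
  have hadj : ∀ a b, G.Adj (g a) (g b) ↔
      ((⊤ : SimpleGraph (Fin 3)) ⊕g (⊥ : SimpleGraph (Fin t))).Adj a b := by
    intro a b
    rw [hGH _ _ (hne a) (hne b)]
    have hR : ∀ j y, ¬ H.Adj (e₂.symm j : V) y := fun j => hiso _ (e₂.symm j).2.2
    rcases a with i | i <;> rcases b with j | j
    · simp only [g, Sum.elim_inl, SimpleGraph.sum_adj, SimpleGraph.top_adj]
      exact ⟨fun h hij => h.ne (by rw [hij]), fun h => htri _ (e₁ i).2 _ (e₁ j).2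
        fun h' => h (e₁.injective (Subtype.ext h'))⟩
    · simpa [g] using fun h => hR j _ (SimpleGraph.Adj.symm h)
    · simpa [g] using hR i _
    · simpa [g] using hR i _
  refine ⟨t, l, ?_, hln, nonempty_iso_addVertex u g hinj hne hsurj hadj ?_⟩
  · obtain ⟨p, hp, hup⟩ := exists_adj_of_closed (C := {x | x = a ∨ x = b ∨ x = c}) hG
      ⟨a, Or.inl rfl⟩ (fun h => hTu u h rfl) hclosed
    have := (hl (e₁.symm ⟨p, hp⟩)).1 (by simpa using hup)
    omega
  · rintro (i | i)
    · simpa [g] using hl i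
    · simpa [g] using adj_of_isolated hG (e₂.symm i).2.1 (hiso _ (e₂.symm i).2.2)

/-- The case where deleting `u` leaves a graph with a single nontrivial component. -/
lemma nonempty_iso_of_mmult_zero (hG : G.Connected)
    (hm : mmult G 0 (Finset.univ.erase u) + 2 = (Finset.univ.erase u).card) :
    (∃ k t l : ℕ, 1 ≤ l ∧ l ≤ k ∧ Nonempty (G ≃g graphK k t l)) ∨
      (∃ k t l : ℕ, 1 ≤ k ∧ l ≤ k ∧ Nonempty (G ≃g graphK' k t l)) ∨
      (∃ t l : ℕ, 1 ≤ l ∧ l ≤ 3 ∧ Nonempty (G ≃g graphL t l)) := by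
  have hP := noP4_deleteIncidenceSet (G := G) (u := u) (card_mroots_le_three hm.ge)
  obtain ⟨a, b, hab⟩ : ∃ a b, (G.deleteIncidenceSet u).Adj a b := by
    by_contra! hno
    have := (mmult_of_edgeless (G := G) (S := Finset.univ.erase u) fun a ha b hb hab =>
      hno a b (SimpleGraph.deleteIncidenceSet_adj.2
        ⟨hab, (Finset.mem_erase.1 ha).1, (Finset.mem_erase.1 hb).1⟩)).1
    omega
  rcases hP.edge_cases hab with hc | hc | ⟨x, hax, hbx⟩
  · exact (nonempty_iso_graphK_or_graphK' hG hm hc).imp_right Or.inl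
  · exact (nonempty_iso_graphK_or_graphK' hG hm hc).imp_right Or.inl
  · exact Or.inr (Or.inr (nonempty_iso_graphL hG hm hP hab hbx hax))

end OneNontrivialComponent

/-! ### A vertex whose deletion leaves equal stars -/

section ManyEqualStars

open scoped Classical Polynomial

open Polynomial

variable {V : Type*} {G : SimpleGraph V} {u : V}

lemma starCentre_closed {c : V} (hc : IsStarCentre (G.deleteIncidenceSet u) c) :
    ∀ a, (a = c ∨ (G.deleteIncidenceSet u).Adj c a) →
      ∀ b, (G.deleteIncidenceSet u).Adj a b → (b = c ∨ (G.deleteIncidenceSet u).Adj c b) := by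
  rintro a (rfl | ha) b hab
  · exact Or.inr hab
  · exact Or.inl (hc.2 a ha b hab)

lemma ne_of_mem_star {c : V} (hc : IsStarCentre (G.deleteIncidenceSet u) c) {a : V}
    (ha : a = c ∨ (G.deleteIncidenceSet u).Adj c a) : a ≠ u := by
  rcases ha with rfl | ha
  · obtain ⟨x, hx⟩ := hc.1
    exact (SimpleGraph.deleteIncidenceSet_adj.1 hx).2.1
  · exact (SimpleGraph.deleteIncidenceSet_adj.1 ha).2.2

lemma exists_edge_outside (hG : G.Connected)
    (hadj : ∀ w, w ≠ u → ∃ x, (G.deleteIncidenceSet u).Adj w x) {C : Set V}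
    (hC : ∀ a ∈ C, ∀ b, (G.deleteIncidenceSet u).Adj a b → b ∈ C)
    (hne : ∃ v, v ≠ u ∧ v ∉ C) :
    ∃ p q, p ≠ u ∧ q ≠ u ∧ p ∉ C ∧ q ∉ C ∧ G.Adj u p ∧ G.Adj p q := by
  have hcl : ∀ a ∈ {v | v ≠ u ∧ v ∉ C}, ∀ b, (G.deleteIncidenceSet u).Adj a b →
      b ∈ {v | v ≠ u ∧ v ∉ C} := fun a ha b hab =>
    ⟨(SimpleGraph.deleteIncidenceSet_adj.1 hab).2.2, fun hb => ha.2 (hC b hb a hab.symm)⟩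
  obtain ⟨p, hp, hup⟩ := exists_adj_of_closed hG hne (fun h => h.1 rfl) hcl
  obtain ⟨q, hpq⟩ := hadj p hp.1
  have hq := hcl p hp q hpq
  exact ⟨p, q, hp.1, hq.1, hp.2, hq.2, hup, (SimpleGraph.deleteIncidenceSet_adj.1 hpq).1⟩

variable [Fintype V]

lemma leaves_edgeless {c : V} (hc : IsStarCentre (G.deleteIncidenceSet u) c) :
    ∀ a ∈ Finset.univ.filter ((G.deleteIncidenceSet u).Adj c),
      ∀ b ∈ Finset.univ.filter ((G.deleteIncidenceSet u).Adj c), ¬ G.Adj a b := by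
  intro a ha b hb hab
  have ha' := (Finset.mem_filter.1 ha).2
  have hb' := (Finset.mem_filter.1 hb).2
  refine hb'.ne' (hc.2 a ha' b (SimpleGraph.deleteIncidenceSet_adj.2 ⟨hab, ?_, ?_⟩))
  · exact (SimpleGraph.deleteIncidenceSet_adj.1 ha').2.2
  · exact (SimpleGraph.deleteIncidenceSet_adj.1 hb').2.2

/-- The matching polynomial of the star `K_{1,k}` is `x^(k+1) - k x^(k-1)`. -/
lemma eval_mp_star {c : V} (hc : IsStarCentre (G.deleteIncidenceSet u) c) {k : ℕ}
    (hk : (Finset.univ.filter ((G.deleteIncidenceSet u).Adj c)).card = k) (t : ℝ) :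
    (mp G (insert c (Finset.univ.filter ((G.deleteIncidenceSet u).Adj c)))).eval t =
      t * t ^ k - k * t ^ (k - 1) := by
  have hnot : c ∉ Finset.univ.filter ((G.deleteIncidenceSet u).Adj c) := by simp
  have hfil : (Finset.univ.filter ((G.deleteIncidenceSet u).Adj c)).filter (G.Adj c) =
      Finset.univ.filter ((G.deleteIncidenceSet u).Adj c) :=
    Finset.filter_true_of_mem fun x hx =>
      (SimpleGraph.deleteIncidenceSet_adj.1 (Finset.mem_filter.1 hx).2).1
  rw [mp_recurrence (Finset.mem_insert_self _ _), Finset.erase_insert hnot, hfil,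
    mp_of_edgeless (leaves_edgeless hc), hk]
  have hw : ∀ w ∈ Finset.univ.filter ((G.deleteIncidenceSet u).Adj c),
      mp G ((Finset.univ.filter ((G.deleteIncidenceSet u).Adj c)).erase w) = X ^ (k - 1) := by
    intro w hw
    rw [mp_of_edgeless, Finset.card_erase_of_mem hw, hk]
    exact fun a ha b hb => leaves_edgeless hc a (Finset.mem_of_mem_erase ha) b
      (Finset.mem_of_mem_erase hb)
  rw [Finset.sum_congr rfl hw, Finset.sum_const, hk]
  simp

/-- If `β` is the only positive root of `G - u`, every star component `K_{1,k}` of `G - u` has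
`k = β²`. -/
lemma card_leaves_eq_sq {β : ℝ}
    (hβ : ∀ θ ∈ mroots G (Finset.univ.erase u), 0 < θ → θ = β) {c : V}
    (hc : IsStarCentre (G.deleteIncidenceSet u) c) :
    ((Finset.univ.filter ((G.deleteIncidenceSet u).Adj c)).card : ℝ) = β ^ 2 := by
  obtain ⟨k, hk⟩ : ∃ k, (Finset.univ.filter ((G.deleteIncidenceSet u).Adj c)).card = k :=
    ⟨_, rfl⟩
  obtain ⟨x, hx⟩ := hc.1
  have hkpos : 0 < k := by
    rw [← hk]
    exact Finset.card_pos.2 ⟨x, by simpa using hx⟩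
  have hk0 : (0 : ℝ) < k := by exact_mod_cast hkpos
  have hroot : (mp G (Finset.univ.erase u)).eval (√(k : ℝ)) = 0 := by
    rw [mp_erase_eq_mul (C := insert c (Finset.univ.filter ((G.deleteIncidenceSet u).Adj c)))
      (fun h => ne_of_mem_star hc (by simpa using h) rfl)
      (by simpa using starCentre_closed hc), eval_mul, eval_mp_star hc hk]
    obtain ⟨j, rfl⟩ := Nat.exists_eq_add_of_lt hkpos
    have := Real.mul_self_sqrt hk0.le
    simp only [zero_add, Nat.add_sub_cancel, pow_succ] at this ⊢
    rw [← sub_eq_zero] at this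
    linear_combination (√((j + 1 : ℕ) : ℝ) ^ j) *
      (mp G (Finset.univ.erase u \
        insert c (Finset.univ.filter ((G.deleteIncidenceSet u).Adj c)))).eval
        (√((j + 1 : ℕ) : ℝ)) * this
  have := hβ _ (Multiset.mem_toFinset.2 ((mem_roots (mp_ne_zero _)).2 hroot))
    (Real.sqrt_pos.2 hk0)
  rw [hk, ← this, Real.sq_sqrt hk0.le]

lemma exists_not_mem_star {β : ℝ} (hβ : 0 < β)
    (hm : 3 ≤ mmult G β (Finset.univ.erase u)) {c : V}
    (hc : IsStarCentre (G.deleteIncidenceSet u) c) :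
    ∃ v, v ≠ u ∧ ¬ (v = c ∨ (G.deleteIncidenceSet u).Adj c v) := by
  by_contra! hall
  have h1 : (Finset.univ.erase u).erase c =
      Finset.univ.filter ((G.deleteIncidenceSet u).Adj c) := by
    ext v
    simp only [Finset.mem_erase, Finset.mem_univ, and_true, Finset.mem_filter, true_and]
    constructor
    · rintro ⟨h1, h2⟩
      exact (hall v h2).resolve_left h1
    · intro h
      exact ⟨h.ne', ne_of_mem_star hc (Or.inr h)⟩
  have h2 := mmult_le_erase (G := G) (θ := β) (S := Finset.univ.erase u) (u := c)
    (by simpa using ne_of_mem_star hc (Or.inl rfl))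
  rw [h1, (mmult_of_edgeless (leaves_edgeless hc)).2 β hβ.ne'] at h2
  omega

/-- No vertex of `G - u` is isolated if deleting `u` lowers the multiplicity of the root `0`: an
isolated vertex `w` would form a path `u w` whose deletion lowers it by two. -/
lemma exists_adj_of_mmult_zero (hG : G.Connected)
    (hm : mmult G 0 (Finset.univ.erase u) + 1 = mmult G 0 Finset.univ) {w : V} (hw : w ≠ u) :
    ∃ x, (G.deleteIncidenceSet u).Adj w x := by
  by_contra! hno
  have huw := adj_of_isolated hG hw hno
  have h1 := mmult_le_erase_edge (θ := 0) (Finset.mem_univ u) (Finset.mem_univ w) huw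
  have hwS : w ∈ Finset.univ.erase u := by simpa using hw
  have h2 : mp G (Finset.univ.erase u) = X * mp G ((Finset.univ.erase u).erase w) := by
    rw [mp_recurrence hwS, Finset.filter_false_of_mem, Finset.sum_empty, sub_zero]
    intro y hy hwy
    exact hno y (SimpleGraph.deleteIncidenceSet_adj.2
      ⟨hwy, hw, (Finset.mem_erase.1 (Finset.mem_of_mem_erase hy)).1⟩)
  have h3 : mmult G 0 (Finset.univ.erase u) =
      1 + mmult G 0 ((Finset.univ.erase u).erase w) := by
    rw [mmult, h2, rootMultiplicity_mul (mul_ne_zero X_ne_zero (mp_ne_zero _)), mmult]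
    congr 1
    have := rootMultiplicity_X_sub_C_self (x := (0 : ℝ))
    simpa using this
  omega

/-- If a component of `G - u` contains a path on three vertices that starts at a neighbour of `u`
and there are further components, then `G` has a path on six vertices. -/
lemma false_of_path_three (hG : G.Connected) (h5 : (mroots G Finset.univ).card = 5)
    (hadj : ∀ w, w ≠ u → ∃ x, (G.deleteIncidenceSet u).Adj w x) {C : Set V}
    (hC : ∀ a ∈ C, ∀ b, (G.deleteIncidenceSet u).Adj a b → b ∈ C)
    (hne : ∃ v, v ≠ u ∧ v ∉ C) {x y z : V} (hx : x ∈ C)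
    (hux : G.Adj u x) (hxy : (G.deleteIncidenceSet u).Adj x y)
    (hyz : (G.deleteIncidenceSet u).Adj y z) (hxz : x ≠ z) : False := by
  obtain ⟨p, q, hpu, hqu, hpC, hqC, hup, hpq⟩ := exists_edge_outside hG hadj hC hne
  have hy := hC x hx y hxy
  have hz := hC y hy z hyz
  have hxp : x ≠ p := fun h => hpC (h ▸ hx)
  have hxq : x ≠ q := fun h => hqC (h ▸ hx)
  have hyp : y ≠ p := fun h => hpC (h ▸ hy)
  have hyq : y ≠ q := fun h => hqC (h ▸ hy)
  have hzp : z ≠ p := fun h => hpC (h ▸ hz)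
  have hzq : z ≠ q := fun h => hqC (h ▸ hz)
  rw [SimpleGraph.deleteIncidenceSet_adj] at hxy hyz
  have := length_le_card_mroots (G := G) (S := Finset.univ) [z, y, x, u, p, q]
    (by simp [hyz.1.symm, hxy.1.symm, hux.symm, hup, hpq])
    (by simp [hyz.1.ne', hxy.1.ne', hux.ne', hup.ne, hpq.ne, hxz.symm, hzp, hzq, hyp, hyq, hxp,
      hxq, hyz.2.2, hyz.2.1, hqu.symm]) (by simp)
  simp only [List.length_cons, List.length_nil] at this
  omega

lemma no_triangle (hG : G.Connected) (h5 : (mroots G Finset.univ).card = 5) {β : ℝ}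
    (hβ : 0 < β) (hm : 3 ≤ mmult G β (Finset.univ.erase u))
    (hP : NoP4 (G.deleteIncidenceSet u))
    (hadj : ∀ w, w ≠ u → ∃ x, (G.deleteIncidenceSet u).Adj w x) {a b c : V}
    (hab : (G.deleteIncidenceSet u).Adj a b) (hbc : (G.deleteIncidenceSet u).Adj b c)
    (hac : (G.deleteIncidenceSet u).Adj a c) : False := by
  have hclosed : ∀ x ∈ ({a, b, c} : Set V), ∀ y, (G.deleteIncidenceSet u).Adj x y →
      y ∈ ({a, b, c} : Set V) := by
    rintro x (rfl | rfl | rfl) y hxy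
    · exact Or.inr (hP.triangle_closed hab hbc hac hxy)
    · rcases hP.triangle_closed hab.symm hac hbc hxy with h | h
      · exact Or.inl h
      · exact Or.inr (Or.inr h)
    · rcases hP.triangle_closed hac.symm hab hbc.symm hxy with h | h
      · exact Or.inl h
      · exact Or.inr (Or.inl h)
  have hne : ∃ v, v ≠ u ∧ v ∉ ({a, b, c} : Set V) := by
    by_contra! hall
    have h1 : Finset.univ.erase u ⊆ {a, b, c} := by
      intro v hv
      simpa using hall v (Finset.mem_erase.1 hv).1
    have h2 := Finset.card_le_card h1
    have h3 : ({a, b, c} : Finset V).card ≤ 3 := Finset.card_le_three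
    have h4 := two_mul_mmult_le (G := G) (S := Finset.univ.erase u) hβ
    omega
  have hu : u ∉ ({a, b, c} : Set V) := by
    rw [SimpleGraph.deleteIncidenceSet_adj] at hab hac
    rintro (h | h | h)
    · exact hab.2.1 h.symm
    · exact hab.2.2 h.symm
    · exact hac.2.2 h.symm
  obtain ⟨p, hp, hup⟩ := exists_adj_of_closed (C := {a, b, c}) hG ⟨a, Or.inl rfl⟩ hu hclosed
  have hfalse := fun x y z hx hux hxy hyz hxz =>
    false_of_path_three (x := x) (y := y) (z := z) hG h5 hadj hclosed hne hx hux hxy hyz hxz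
  rcases hp with rfl | rfl | rfl
  · exact hfalse _ _ _ (by simp) hup hab hbc hac.ne
  · exact hfalse _ _ _ (by simp) hup hbc hac.symm hab.ne'
  · exact hfalse _ _ _ (by simp) hup hac.symm hab hbc.ne'

lemma nonempty_iso_graphT (hG : G.Connected) {k : ℕ}
    (hedge : ∀ v w, (G.deleteIncidenceSet u).Adj v w →
      IsStarCentre (G.deleteIncidenceSet u) v ∨ IsStarCentre (G.deleteIncidenceSet u) w)
    (hadj : ∀ w, w ≠ u → ∃ x, (G.deleteIncidenceSet u).Adj w x)
    (hcard : ∀ c, IsStarCentre (G.deleteIncidenceSet u) c →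
      (Finset.univ.filter ((G.deleteIncidenceSet u).Adj c)).card = k)
    (hleaf : ∀ c x, IsStarCentre (G.deleteIncidenceSet u) c →
      (G.deleteIncidenceSet u).Adj c x → ¬ G.Adj u x) (hne : ∃ v, v ≠ u) :
    ∃ r : ℕ, 1 ≤ r ∧ Nonempty (G ≃g graphT r k) := by
  set H := G.deleteIncidenceSet u with hH
  have hGH : ∀ a b, a ≠ u → b ≠ u → (G.Adj a b ↔ H.Adj a b) := fun a b ha hb => by
    rw [hH, SimpleGraph.deleteIncidenceSet_adj]
    tauto
  -- The centres of the star components are exactly the neighbours of `u`.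
  have hcu : ∀ c, IsStarCentre H c → G.Adj u c := by
    intro c hc
    obtain ⟨p, hp, hup⟩ := exists_adj_of_closed (C := {a | a = c ∨ H.Adj c a}) hG
      ⟨c, Or.inl rfl⟩ (fun h => ne_of_mem_star hc h rfl) (starCentre_closed hc)
    rcases hp with rfl | hp
    · exact hup
    · exact absurd hup (hleaf c p hc hp)
  have huc : ∀ c, G.Adj u c → IsStarCentre H c := by
    intro c hc
    obtain ⟨x, hx⟩ := hadj c hc.ne'
    rcases hedge c x hx with h | h
    · exact h
    · exact absurd hc (hleaf x c h hx.symm)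
  obtain ⟨r, ⟨e₁⟩⟩ := Finite.exists_equiv_fin {x // G.Adj u x}
  have he : ∀ c : {x // G.Adj u x}, Nonempty (Fin k ≃ {x // H.Adj c x}) := by
    intro c
    refine ⟨(Fintype.equivFinOfCardEq ?_).symm⟩
    rw [Fintype.card_subtype]
    exact hcard c (huc c c.2)
  have e₂ := fun c => (he c).some
  let g : Fin r × (Fin 1 ⊕ Fin k) → V := fun p =>
    Sum.elim (fun _ => (e₁.symm p.1 : V)) (fun j => (e₂ (e₁.symm p.1) j : V)) p.2
  have hcen : ∀ i, IsStarCentre H (e₁.symm i : V) := fun i => huc _ (e₁.symm i).2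
  have hnu : ∀ i j, ¬ G.Adj u (e₂ (e₁.symm i) j : V) := fun i j =>
    hleaf _ _ (hcen i) (e₂ (e₁.symm i) j).2
  have hgne : ∀ a, g a ≠ u := by
    rintro ⟨i, x | j⟩
    · exact (e₁.symm i).2.ne'
    · exact (SimpleGraph.deleteIncidenceSet_adj.1 (e₂ (e₁.symm i) j).2).2.2
  have hinj : Function.Injective g := by
    rintro ⟨i, x | a⟩ ⟨j, y | b⟩ h
    · have : i = j := e₁.symm.injective (Subtype.ext h)
      rw [this, Subsingleton.elim x y]
    · exact absurd (by rw [← show (e₁.symm i : V) = e₂ (e₁.symm j) b from h]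
                       exact (e₁.symm i).2) (hnu j b)
    · exact absurd (by rw [show (e₂ (e₁.symm i) a : V) = e₁.symm j from h]
                       exact (e₁.symm j).2) (hnu i a)
    · have h' : (e₂ (e₁.symm i) a : V) = e₂ (e₁.symm j) b := h
      have hij : i = j := by
        refine e₁.symm.injective (Subtype.ext ?_)
        refine (hcen j).2 _ (e₂ (e₁.symm j) b).2 _ ?_
        rw [← h']
        exact (e₂ (e₁.symm i) a).2.symm
      subst hij
      rw [(e₂ (e₁.symm i)).injective (Subtype.ext h')]
  have hsurj : ∀ v, v ≠ u → ∃ a, g a = v := by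
    intro v hv
    by_cases huv : G.Adj u v
    · exact ⟨(e₁ ⟨v, huv⟩, Sum.inl 0), by simp [g]⟩
    · obtain ⟨c, hc⟩ := hadj v hv
      have hcc : IsStarCentre H c := by
        rcases hedge v c hc with h | h
        · exact absurd (hcu v h) huv
        · exact h
      obtain ⟨i, hi⟩ := e₁.symm.surjective ⟨c, hcu c hcc⟩
      have hiv : H.Adj (e₁.symm i : V) v := by
        rw [hi]
        exact hc.symm
      refine ⟨(i, Sum.inr ((e₂ (e₁.symm i)).symm ⟨v, hiv⟩)), ?_⟩
      simp [g]
  refine ⟨r, ?_, nonempty_iso_addVertex u g hinj hgne hsurj ?_ ?_⟩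
  · obtain ⟨v, hv⟩ := hne
    obtain ⟨a, -⟩ := hsurj v hv
    exact Fin.pos a.1
  · rintro ⟨i, x | a⟩ ⟨j, y | b⟩ <;> rw [hGH _ _ (hgne _) (hgne _)]
    · simp only [g, copies, star, Sum.elim_inl, completeBipartiteGraph_adj, Sum.isRight_inl,
        Bool.false_eq_true, and_false, false_and, or_false, iff_false]
      exact fun h => hleaf _ _ (hcen i) h (e₁.symm j).2
    · simp only [g, copies, star, Sum.elim_inl, Sum.elim_inr, completeBipartiteGraph_adj,
        Sum.isLeft_inl, Sum.isRight_inr, and_self, true_or, and_true]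
      constructor
      · intro h
        exact e₁.symm.injective (Subtype.ext ((hcen j).2 _ (e₂ (e₁.symm j) b).2 _ h.symm))
      · rintro rfl
        exact (e₂ (e₁.symm i) b).2
    · simp only [g, copies, star, Sum.elim_inl, Sum.elim_inr, completeBipartiteGraph_adj,
        Sum.isLeft_inl, Sum.isRight_inr, and_self, or_true, and_true]
      constructor
      · intro h
        exact (e₁.symm.injective (Subtype.ext ((hcen i).2 _ (e₂ (e₁.symm i) a).2 _ h))).symm
      · rintro rfl
        exact (e₂ (e₁.symm i) a).2.symm
    · simp only [g, copies, star, Sum.elim_inr, completeBipartiteGraph_adj, Sum.isLeft_inr,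
        Bool.false_eq_true, and_false, false_and, or_false, iff_false]
      intro h
      refine hnu j b ?_
      rw [(hcen i).2 _ (e₂ (e₁.symm i) a).2 _ h]
      exact (e₁.symm i).2
  · rintro ⟨i, x | a⟩
    · simpa [g, Subsingleton.elim x 0] using (e₁.symm i).2
    · simpa [g] using hnu i a

lemma nonempty_iso_graphS (hG : G.Connected)
    (huniq : ∀ v, v ≠ u → ∃! w, (G.deleteIncidenceSet u).Adj v w) (hne : ∃ v, v ≠ u) :
    ∃ r s : ℕ, 1 ≤ r ∧ r ≤ s ∧ s ≤ 2 * r ∧ Nonempty (G ≃g graphS r s) := by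
  set H := G.deleteIncidenceSet u with hH
  have hGH : ∀ a b, a ≠ u → b ≠ u → (G.Adj a b ↔ H.Adj a b) := fun a b ha hb => by
    rw [hH, SimpleGraph.deleteIncidenceSet_adj]
    tauto
  have hHu : ∀ {a b}, H.Adj a b → a ≠ u ∧ b ≠ u := fun h =>
    (SimpleGraph.deleteIncidenceSet_adj.1 h).2
  choose! p hp hpu using huniq
  simp only at hp hpu
  have hpp : ∀ v, v ≠ u → p (p v) = v := fun v hv =>
    (hpu (p v) (hHu (hp v hv)).2 v (hp v hv).symm).symm
  have hor : ∀ v, v ≠ u → G.Adj u v ∨ G.Adj u (p v) := by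
    intro v hv
    obtain ⟨x, hx, hux⟩ := exists_adj_of_closed (C := {a | a = v ∨ a = p v}) hG
      ⟨v, Or.inl rfl⟩ (by
        rintro (h | h)
        · exact hv h.symm
        · exact (hHu (hp v hv)).2 h.symm) (by
        rintro a (rfl | rfl) b hab
        · exact Or.inr (hpu _ hv b hab)
        · refine Or.inl ?_
          have := hpu _ (hHu hab).1 b hab
          rwa [hpp v hv] at this)
    rcases hx with rfl | rfl
    · exact Or.inl hux
    · exact Or.inr hux
  -- In each copy of `K₂` one end adjacent to `u` is chosen, the first one in an enumeration of
  -- the vertices if both ends are adjacent to `u`.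
  obtain ⟨n, ⟨f⟩⟩ := Finite.exists_equiv_fin V
  obtain ⟨r, l, e, hlr, hl⟩ := exists_fin_equiv_lt
    (α := {v // v ≠ u ∧ G.Adj u v ∧ (G.Adj u (p v) → f v < f (p v))}) fun v => G.Adj u (p v)
  let g : Fin r × Fin 2 → V := fun q => if q.2 = 0 then (e q.1 : V) else p (e q.1 : V)
  have hg0 : ∀ i, g (i, 0) = (e i : V) := fun i => by simp [g]
  have hg1 : ∀ i, g (i, 1) = p (e i : V) := fun i => by simp [g]
  have hpe : ∀ i, p (e i : V) ≠ u := fun i => (hHu (hp _ (e i).2.1)).2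
  have hep : ∀ i j, (e i : V) ≠ p (e j : V) := by
    intro i j h
    have h1 := (e i).2.2
    have h2 := (e j).2.2
    have h3 : p (e i : V) = e j := by rw [h, hpp _ (e j).2.1]
    rw [h3] at h1
    rw [← h] at h2
    exact lt_asymm (h1.2 h2.1) (h2.2 h1.1)
  have hgne : ∀ a, g a ≠ u := by
    rintro ⟨i, j⟩
    fin_cases j
    · exact (e i).2.1
    · exact hpe i
  have hpinj : ∀ i j, p (e i : V) = p (e j : V) → i = j := by
    intro i j h
    refine e.injective (Subtype.ext ?_)
    rw [← hpp _ (e i).2.1, h, hpp _ (e j).2.1]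
  have hinj : Function.Injective g := by
    rintro ⟨i, a⟩ ⟨j, b⟩ h
    fin_cases a <;> fin_cases b
    · exact congrArg (fun i => (i, (0 : Fin 2))) (e.injective (Subtype.ext h))
    · exact absurd h (hep i j)
    · exact absurd (Eq.symm h) (hep j i)
    · exact congrArg (fun i => (i, (1 : Fin 2))) (hpinj i j h)
  have hsurj : ∀ v, v ≠ u → ∃ a, g a = v := by
    intro v hv
    have hpv : p v ≠ u := (hHu (hp v hv)).2
    have hne' : f v ≠ f (p v) := fun h => (hp v hv).ne (f.injective h)
    by_cases hrep : G.Adj u v ∧ (G.Adj u (p v) → f v < f (p v))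
    · exact ⟨(e.symm ⟨v, hv, hrep⟩, 0), by rw [hg0]; simp⟩
    · have hrep' : G.Adj u (p v) ∧ (G.Adj u (p (p v)) → f (p v) < f (p (p v))) := by
        rw [hpp v hv]
        by_cases h1 : G.Adj u v
        · have h2 : ¬ (G.Adj u (p v) → f v < f (p v)) := fun h => hrep ⟨h1, h⟩
          push Not at h2
          exact ⟨h2.1, fun _ => lt_of_le_of_ne h2.2 hne'.symm⟩
        · exact ⟨(hor v hv).resolve_left h1, fun h => absurd h h1⟩
      refine ⟨(e.symm ⟨p v, hpv, hrep'⟩, 1), ?_⟩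
      rw [hg1]
      simpa using hpp v hv
  refine ⟨r, r + l, ?_, by omega, by omega,
    nonempty_iso_addVertex u g hinj hgne hsurj ?_ ?_⟩
  · obtain ⟨v, hv⟩ := hne
    obtain ⟨a, -⟩ := hsurj v hv
    exact Fin.pos a.1
  · rintro ⟨i, a⟩ ⟨j, b⟩
    rw [hGH _ _ (hgne _) (hgne _)]
    have key : H.Adj (g (i, a)) (g (j, b)) ↔ g (j, b) = p (g (i, a)) :=
      ⟨hpu _ (hgne _) _, fun h => h ▸ hp _ (hgne _)⟩
    rw [key]
    have h10 : (1 : Fin 2) ≠ 0 := by decide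
    fin_cases a <;> fin_cases b <;> simp only [Fin.zero_eta, Fin.mk_one, hg0, hg1, copies,
      SimpleGraph.top_adj, ne_eq, not_true_eq_false, and_false, iff_false, h10, h10.symm,
      not_false_eq_true, and_true]
    · exact hep j i
    · exact ⟨fun h => (hpinj j i h).symm, fun h => by rw [h]⟩
    · rw [hpp _ (e i).2.1]
      exact ⟨fun h => (e.injective (Subtype.ext h)).symm, fun h => by rw [h]⟩
    · rw [hpp _ (e i).2.1]
      exact fun h => hep i j h.symm
  · rintro ⟨i, a⟩
    fin_cases a
    · simpa [g] using (e i).2.2.1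
    · have := hl i
      simp only [Fin.mk_one, hg1, Set.mem_ofPred_eq]
      rw [this]
      simp only [Fin.isValue, one_ne_zero, true_and, false_or]
      omega

/-- The case of a multiple root `β > 0`: the components of `G - u` are stars `K_{1,k}` with
`k = β²`. -/
lemma nonempty_iso_of_mmult_pos (hG : G.Connected) (h5 : (mroots G Finset.univ).card = 5)
    {β : ℝ} (hβ : 0 < β) (hm : 3 ≤ mmult G β (Finset.univ.erase u))
    (hroots : ∀ θ ∈ mroots G (Finset.univ.erase u), 0 < θ → θ = β)
    (hm0 : mmult G 0 (Finset.univ.erase u) + 1 = mmult G 0 Finset.univ) :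
    (∃ r k : ℕ, 1 ≤ r ∧ 1 ≤ k ∧ Nonempty (G ≃g graphT r k)) ∨
      (∃ r s : ℕ, 1 ≤ r ∧ r ≤ s ∧ s ≤ 2 * r ∧ Nonempty (G ≃g graphS r s)) := by
  have hthree : (mroots G (Finset.univ.erase u)).card ≤ 3 := by
    have h1 := card_mroots_eq (G := G) (Finset.univ.erase u)
    have h2 : ((mroots G (Finset.univ.erase u)).filter fun θ => 0 < θ).card ≤ 1 := by
      rw [Finset.card_le_one]
      intro a ha b hb
      rw [Finset.mem_filter] at ha hb
      rw [hroots a ha.1 ha.2, hroots b hb.1 hb.2]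
    split_ifs at h1 <;> omega
  have hP := noP4_deleteIncidenceSet hthree
  have hadj : ∀ w, w ≠ u → ∃ x, (G.deleteIncidenceSet u).Adj w x := fun w hw =>
    exists_adj_of_mmult_zero hG hm0 hw
  have hedge : ∀ v w, (G.deleteIncidenceSet u).Adj v w →
      IsStarCentre (G.deleteIncidenceSet u) v ∨ IsStarCentre (G.deleteIncidenceSet u) w := by
    intro v w hvw
    rcases hP.edge_cases hvw with h | h | ⟨x, hvx, hwx⟩
    · exact Or.inl h
    · exact Or.inr h
    · exact (no_triangle hG h5 hβ hm hP hadj hvw hwx hvx).elim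
  have hne : ∃ v, v ≠ u := by
    have h1 := two_mul_mmult_le (G := G) (S := Finset.univ.erase u) hβ
    obtain ⟨v, hv⟩ : (Finset.univ.erase u).Nonempty := Finset.card_pos.1 (by omega)
    exact ⟨v, (Finset.mem_erase.1 hv).1⟩
  obtain ⟨c₀, hc₀⟩ : ∃ c, IsStarCentre (G.deleteIncidenceSet u) c := by
    obtain ⟨v, hv⟩ := hne
    obtain ⟨x, hx⟩ := hadj v hv
    rcases hedge v x hx with h | h
    exacts [⟨v, h⟩, ⟨x, h⟩]
  obtain ⟨k, hk⟩ : ∃ k, (Finset.univ.filter ((G.deleteIncidenceSet u).Adj c₀)).card = k :=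
    ⟨_, rfl⟩
  have hcard : ∀ c, IsStarCentre (G.deleteIncidenceSet u) c →
      (Finset.univ.filter ((G.deleteIncidenceSet u).Adj c)).card = k := by
    intro c hc
    have h1 := card_leaves_eq_sq hroots hc
    rw [← card_leaves_eq_sq hroots hc₀, hk] at h1
    exact_mod_cast h1
  have hkpos : 1 ≤ k := by
    obtain ⟨x, hx⟩ := hc₀.1
    rw [← hk]
    exact Finset.card_pos.2 ⟨x, by simpa using hx⟩
  rcases hkpos.eq_or_lt with rfl | hk2
  · refine Or.inr (nonempty_iso_graphS hG (fun v hv => ?_) hne)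
    obtain ⟨w, hw⟩ := hadj v hv
    refine ⟨w, hw, fun y hy => ?_⟩
    rcases hedge v w hw with h | h
    · exact Finset.card_le_one.1 (hcard v h).le y (by simpa using hy) w (by simpa using hw)
    · exact h.2 v hw.symm y hy
  · obtain ⟨r, hr, hiso⟩ := nonempty_iso_graphT hG hedge hadj hcard (fun c x hc hx hux => by
      obtain ⟨y, hy, hyx⟩ := Finset.exists_mem_ne (by rw [hcard c hc]; exact hk2) x
      exact false_of_path_three (C := {a | a = c ∨ (G.deleteIncidenceSet u).Adj c a}) hG h5 hadj
        (starCentre_closed hc) (exists_not_mem_star hβ hm hc) (Or.inr hx) hux hx.symm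
        (Finset.mem_filter.1 hy).2 hyx.symm) hne
    exact Or.inl ⟨r, k, hr, hkpos, hiso⟩

end ManyEqualStars

end MatchingRoots

theorem mainTheorem1 {V : Type*} [Fintype V] (G : SimpleGraph V) (hG : G.Connected) :
    (MatchingRoots.numMatchingRoots G = 2 →
      Nonempty (G ≃g (⊤ : SimpleGraph (Fin 2)))) ∧
    (MatchingRoots.numMatchingRoots G = 3 →
      MatchingRoots.IsStar G ∨ Nonempty (G ≃g (⊤ : SimpleGraph (Fin 3)))) ∧
    (MatchingRoots.numMatchingRoots G = 4 →
      Fintype.card V = 4 ∧ ¬ MatchingRoots.IsStar G) ∧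
    (MatchingRoots.numMatchingRoots G = 5 →
      (∃ k t l : ℕ, 1 ≤ l ∧ l ≤ k ∧ Nonempty (G ≃g MatchingRoots.graphK k t l)) ∨
      (∃ k t l : ℕ, 1 ≤ k ∧ l ≤ k ∧ Nonempty (G ≃g MatchingRoots.graphK' k t l)) ∨
      (∃ t l : ℕ, 1 ≤ l ∧ l ≤ 3 ∧ Nonempty (G ≃g MatchingRoots.graphL t l)) ∨
      (∃ r k : ℕ, 1 ≤ r ∧ 1 ≤ k ∧ Nonempty (G ≃g MatchingRoots.graphT r k)) ∨
      (∃ r s : ℕ, 1 ≤ r ∧ r ≤ s ∧ s ≤ 2 * r ∧ Nonempty (G ≃g MatchingRoots.graphS r s)) ∨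
      (Fintype.card V = 5 ∧ ¬ MatchingRoots.IsStar G)) := by
  rw [MatchingRoots.numMatchingRoots_eq]
  refine ⟨fun h => ?_, fun h => ?_, fun h => ?_, fun h => ?_⟩
  · exact MatchingRoots.nonempty_iso_top_two hG h
  · exact MatchingRoots.isStar_or_nonempty_iso_top_three hG h
  · refine ⟨MatchingRoots.card_eq_four hG h, fun hs => ?_⟩
    have := MatchingRoots.card_mroots_of_isStar hs
    omega
  · rcases MatchingRoots.exists_vertex_of_five_roots hG h with hV | ⟨u, hu⟩ |
      ⟨u, β, hβ, hm, hroots, hm0⟩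
    · refine Or.inr (Or.inr (Or.inr (Or.inr (Or.inr ⟨hV, fun hs => ?_⟩))))
      have := MatchingRoots.card_mroots_of_isStar hs
      omega
    · rcases MatchingRoots.nonempty_iso_of_mmult_zero hG hu with h1 | h1 | h1
      · exact Or.inl h1
      · exact Or.inr (Or.inl h1)
      · exact Or.inr (Or.inr (Or.inl h1))
    · rcases MatchingRoots.nonempty_iso_of_mmult_pos hG h hβ hm hroots hm0 with h1 | h1
      · exact Or.inr (Or.inr (Or.inr (Or.inl h1)))
      · exact Or.inr (Or.inr (Or.inr (Or.inr (Or.inl h1))))
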